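/- Let $n\ge 1$ and $1\le p<\infty$. For $u:\mathbb R^n\to\mathbb R\cup\{+\infty\}$ let $u^*(y)=\sup_x\{\langle x,y\rangle-u(x)\}$. Let $\mathcal A_0$ be the set of functions $f=e^{-u}$ with $u:\mathbb R^n\to\mathbb R\cup\{+\infty\}$ proper and convex, $u(x)\to+\infty$ as $|x|\to\infty$, $u\ge 0$, $u^{**}=u$ and $u(o)=0$. For $f=e^{-u}\in\mathcal A_0$ write $h_f=u^*$, $J(f)=\int_{\mathbb R^n}f\,dx$ and $J(f^\diamond)=J(nf+f\log f)$. For $f,g\in\mathcal A_0$ and $\alpha,\beta\ge0$ let $\alpha\cdot_p f\oplus_p\beta\cdot_p g=e^{-w}$ with $w=\big[(\alpha h_f^p+\beta h_g^p)^{1/p}\big]^*$, and set $$\delta J_p(f,g)=\lim_{t\to0^+}\frac{J(f\oplus_p t\cdot_p g)-J(f)}{t},\qquad \overline\delta J_p(f,g)=\Big(\frac{p\,\delta J_p(f,g)}{J(f^\diamond)}\Big)^{1/p},\qquad \overline\delta J_\infty(f,g)=\sup_x\frac{h_g(x)}{h_f(x)}$$ (with $0/0=0$ in the supremum). Let $\mu_p(f,\cdot)$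 be the image under $\nabla u$ of the measure $h_f(\nabla u(x))^{1-p}f(x)\,dx$ on the set of points of $\operatorname{int}(\operatorname{dom}u)$ where $u$ is differentiable, powers being taken in $[0,+\infty]$. For $\phi\in GL(n)$ let $\gamma_\phi(x)=e^{-\|\phi x\|^2/2}$, let $\gamma=\gamma_I$, and let $c_n=(2\pi)^{n/2}$. **Theorem.** Let $f\in\mathcal A_0$ with $\overline\delta J_\infty(f,\gamma)<\infty$. Then $J(f^\diamond)>0$, the limit $\delta J_p(f,\gamma_\phi)$ exists and is finite for every $\phi\in GL(n)$, and the problem $$S_p:\qquad \max_{\phi\in GL(n)}\ \frac{J(\gamma_\phi)}{c_n}\quad\text{subject to}\quad \overline\delta J_p(f,\gamma_\phi)\le 1$$ has a solution, and the Gaussian function $\gamma_\phi$ that solves it is unique (it is called the $L_p$ John ellipsoid $E_pf$ of $f$). Moreover, for $\phi\in GL(n)$ put $\alpha=(c_n/J(\gamma_\phi))^{2/n}$. Then $\gamma_\phi$ solves $S_p$ if and only if $\overline\delta J_p(f,\gamma_\phi)=1$ and, for every $y\in\mathbb R^n$, $$\alpha^p\,\delta J_p(f,\gamma_\phi)\,h_\gamma\big(\tfrac1{\sqrt\alpha}\,\phi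 y\big)=\frac{n}{4p}\int_{\mathbb R^n}|\langle x,y\rangle|^2\,h_\gamma\big(\sqrt\alpha\,\phi^{-t}x\big)^{p-1}\,d\mu_p(f,x),$$ where the integral on the right converges absolutely for every $\phi\in GL(n)$ and every $y\in\mathbb R^n$. -/

import Mathlib

open Filter Topology MeasureTheory
open scoped ENNReal RealInnerProductSpace

noncomputable section

namespace LpJohn

/-- Euclidean space `ℝⁿ`. -/
abbrev E (n : ℕ) : Type := EuclideanSpace ℝ (Fin n)

variable {n : ℕ}

/-! ## Convex functions with values in `(-∞, +∞]` and log-concave functions -/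

/-- Convexity of an extended-real-valued function. -/
def IsConvexFn (u : E n → EReal) : Prop :=
  ∀ x y : E n, ∀ t : ℝ, 0 < t → t < 1 →
    u ((1 - t) • x + t • y) ≤ ((1 - t : ℝ) : EReal) * u x + (t : EReal) * u y

/-- The Fenchel conjugate `u*(y) = sup_x (⟨x, y⟩ - u(x))`. -/
def conj (u : E n → EReal) (y : E n) : EReal :=
  ⨆ x : E n, ((⟪x, y⟫ : ℝ) : EReal) - u x

/-- The class `𝓛` of proper convex `u : ℝⁿ → ℝ ∪ {+∞}` with `u(x) → +∞` as `|x| → +∞`. -/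
def classL (n : ℕ) : Set (E n → EReal) :=
  {u | (∀ x, u x ≠ ⊥) ∧ (∃ x, u x ≠ ⊤) ∧ IsConvexFn u ∧ Tendsto u (cocompact (E n)) (𝓝 ⊤)}

/-- The class `𝓛₀` of `u ∈ 𝓛` with `u ≥ 0`, `u** = u` and `u(o) = 0`. -/
def classL0 (n : ℕ) : Set (E n → EReal) :=
  {u | u ∈ classL n ∧ (∀ x, 0 ≤ u x) ∧ conj (conj u) = u ∧ u 0 = 0}

/-- The function `e^{-u}`, with `e^{-∞} = 0`. -/
def expNeg (u : E n → EReal) (x : E n) : ℝ := (EReal.exp (-(u x))).toReal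

/-- The class `𝓐₀ = {e^{-u} : u ∈ 𝓛₀}` of log-concave functions. -/
def classA0 (n : ℕ) : Set (E n → ℝ) := {f | ∃ u ∈ classL0 n, f = expNeg u}

/-- The function `-log f`, with `-log 0 = +∞`. For `f = e^{-u}` it is `u`. -/
def negLog (f : E n → ℝ) (x : E n) : EReal := -ENNReal.log (ENNReal.ofReal (f x))

/-- The support function `h_f = (-log f)*` of a log-concave function `f`. -/
def supportFn (f : E n → ℝ) : E n → EReal := conj (negLog f)

/-! ## Total mass, `L_p` Asplund sum, first variation -/

/-- The total mass `J(f) = ∫ f dx`. -/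
def J (f : E n → ℝ) : ℝ := ∫ x, f x

/-- `J(f^⋄) = J(n f + f log f)`. -/
def diamondMass (f : E n → ℝ) : ℝ := J (fun x => n * f x + f x * Real.log (f x))

/-- The `L_p` Asplund sum `α ·_p f ⊕_p β ·_p g = e^{-w}`, where
`w = ((α h_f^p + β h_g^p)^{1/p})*` (the support functions of `f, g ∈ 𝓐₀` take values in
`[0, +∞]`). -/
def asplundSum (p : ℝ) (α : ℝ) (f : E n → ℝ) (β : ℝ) (g : E n → ℝ) : E n → ℝ :=
  expNeg (conj fun y =>
    (((ENNReal.ofReal α * (supportFn f y).toENNReal ^ p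
      + ENNReal.ofReal β * (supportFn g y).toENNReal ^ p) ^ (1 / p) : ℝ≥0∞) : EReal))

/-- The first variation of the total mass at `f` along `g` exists and is equal to `d`:
`d = lim_{t → 0⁺} (J(f ⊕_p t ·_p g) - J(f)) / t`. -/
def HasFirstVariation (p : ℝ) (f g : E n → ℝ) (d : ℝ) : Prop :=
  Tendsto (fun t : ℝ => (J (asplundSum p 1 f t g) - J f) / t) (𝓝[>] 0) (𝓝 d)

/-- The first variation `δJ_p(f, g)` of the total mass, meaningful when the limit exists. -/
def firstVariation (p : ℝ) (f g : E n → ℝ) : ℝ :=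
  limUnder (𝓝[>] (0 : ℝ)) fun t : ℝ => (J (asplundSum p 1 f t g) - J f) / t

/-- The normalized first variation `(p δJ_p(f, g) / J(f^⋄))^{1/p}` for `1 ≤ p < ∞`. -/
def normFirstVariation (p : ℝ) (f g : E n → ℝ) : ℝ :=
  (p * firstVariation p f g / diamondMass f) ^ (1 / p)

/-- The normalized first variation for `p = ∞`: the supremum of `h_g / h_f` in `[0, +∞]`
(with `0 / 0 = 0`). -/
def normFirstVariationTop (f g : E n → ℝ) : ℝ≥0∞ :=
  ⨆ x : E n, (supportFn g x).toENNReal / (supportFn f x).toENNReal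

/-! ## The `L_p` surface area measure -/

/-- The gradient of `u = -log f`, used at the points of `gradDomain f`. -/
def gradU (f : E n → ℝ) : E n → E n := gradient fun x => (negLog f x).toReal

/-- The points of the interior of `dom u`, `u = -log f`, at which `u` is differentiable. -/
def gradDomain (f : E n → ℝ) : Set (E n) :=
  {x | x ∈ interior {z | negLog f z ≠ ⊤} ∧ DifferentiableAt ℝ (fun z => (negLog f z).toReal) x}

/-- The `L_p` surface area measure `μ_p(f, ·)`: the image under `∇u` of the measure with density
`h_f(∇u(x))^{1-p} f(x)` on the set of differentiability of `u = -log f`. Powers are taken in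
`[0, +∞]`, so that `0^{1-p} = +∞` for `p > 1` and `0^0 = 1`. -/
def surfaceMeasure (p : ℝ) (f : E n → ℝ) : Measure (E n) :=
  ((volume.restrict (gradDomain f)).withDensity fun x =>
    (supportFn f (gradU f x)).toENNReal ^ (1 - p) * ENNReal.ofReal (f x)).map (gradU f)

/-! ## Gaussian functions and the maximization problem -/

/-- The linear action of a real matrix on `ℝⁿ`. -/
def act (A : Matrix (Fin n) (Fin n) ℝ) (x : E n) : E n := Matrix.toEuclideanLin A x

/-- The Gaussian function `γ_φ(x) = exp(-‖φ x‖² / 2)`, `φ ∈ GL(n)`. -/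
def gaussian (φ : GL (Fin n) ℝ) (x : E n) : ℝ := Real.exp (-(‖act φ.val x‖ ^ 2 / 2))

/-- `c_n = (2π)^{n/2}`. -/
def gaussConst (n : ℕ) : ℝ := (2 * Real.pi) ^ ((n : ℝ) / 2)

/-- `g` solves the problem of maximizing `J(γ_ψ) / c_n` over all Gaussian functions `γ_ψ`,
`ψ ∈ GL(n)`, for which the normalized first variation at `f` along `γ_ψ` is at most `1`. -/
def IsSolution (p : ℝ) (f g : E n → ℝ) : Prop :=
  (∃ φ : GL (Fin n) ℝ, g = gaussian φ) ∧ normFirstVariation p f g ≤ 1 ∧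
    ∀ ψ : GL (Fin n) ℝ, normFirstVariation p f (gaussian ψ) ≤ 1 →
      J (gaussian ψ) / gaussConst n ≤ J g / gaussConst n

/-- The scaling factor `α = (c_n / J(γ_φ))^{2/n}`, for which `α^p ·_p γ_φ` has total mass `c_n`. -/
def scale (φ : GL (Fin n) ℝ) : ℝ := (gaussConst n / J (gaussian φ)) ^ (2 / (n : ℝ))

/-- `h_γ(√α φ^{-t} x)`, the value at `x` of the support function of
`α^p ·_p γ_φ = γ_{φ / √α}`. -/
def scaledSupport (φ : GL (Fin n) ℝ) (x : E n) : ℝ :=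
  (supportFn (gaussian (1 : GL (Fin n) ℝ))
    (Real.sqrt (scale φ) • act (φ⁻¹).val.transpose x)).toReal

/-- `h_γ(φ y / √α)`, the value at `y` of the support function of the polar function
`(γ_{φ / √α})° = γ_{√α φ^{-t}}`. -/
def scaledPolarSupport (φ : GL (Fin n) ℝ) (y : E n) : ℝ :=
  (supportFn (gaussian (1 : GL (Fin n) ℝ)) ((Real.sqrt (scale φ))⁻¹ • act φ.val y)).toReal

end LpJohn

end

/-! ### Reduction to a finite convex function -/

namespace LpJohn

variable {n : ℕ}

/-! The support function of `γ_φ` is `‖φ^{-t} y‖² / 2`, so the hypothesis on `f` says that `‖y‖² ≤ C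
h_f(y)`. Conjugation turns this into `u ≤ K ‖x‖²`: `u` is finite, hence differentiable almost
everywhere, and `h_f(∇u(x)) = ⟨x, ∇u(x)⟩ - u(x)` is at most quadratic (`exists_convexPair`,
`conj_gradient`).

These bounds let both quantities in the constraint be computed by dominated convergence. Pointwise
differentiation of the perturbed conjugates gives `δJ_p(f, γ_φ) = (1/p) ∫ (‖φ^{-t} x‖² / 2)^p dμ_p`
(`tendsto_sub_conj_pSum_div`, `hasFirstVariation_gaussian`). Differentiating `∫ e^{-u}` under
dilations gives `J(f^⋄) = ∫ h_f(∇u) f`, which is positive (`diamondMass_eq`, `diamondMass_pos`).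

Since `J(γ_φ) = c_n / |det φ|`, the problem becomes one about matrices: maximize `|det T|`, `T =
φ^{-t}`, subject to `∫ (‖T x‖² / 2)^p dμ_p ≤ D` with `D = J(f^⋄)`. The moment is homogeneous of
degree `2p` and, as `μ_p` is not carried by a hyperplane, positive for `T ≠ 0`. So the feasible set
is compact and a maximizer exists, with the constraint active. Perturbing it by the rank-one
matrices `s (φ y) yᵗ` yields the stated identity as first-order condition
(`IsOptimal.mul_sq_norm_eq`).

Conversely, the tangent inequality for `a ↦ a^p` combined with the identity gives `‖φ ψ⁻¹‖²_HS ≤ n`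
for every feasible `ψ`. The arithmetic-geometric mean inequality then gives `|det φ| ≤ |det ψ|`,
with equality only if `φ ψ⁻¹` is orthogonal, that is, `γ_φ = γ_ψ`
(`isOptimal_of_forall_mul_sq_norm_eq`). This proves sufficiency and uniqueness together. -/

/-- A finite convex function `U` with its conjugate `k`, under the growth conditions that follow from
membership in `𝓛₀` and a quadratic lower bound on `k`. -/
structure ConvexPair (U : E n → ℝ) (k : E n → ℝ≥0∞) : Prop where
  convex : ConvexOn ℝ Set.univ U
  nonneg : ∀ x, 0 ≤ U x
  zero : U 0 = 0
  coercive : ∃ R : ℝ, 0 < R ∧ ∀ x, ‖x‖ / R - 1 ≤ U x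
  quad : ∃ K : ℝ, 0 ≤ K ∧ ∀ x, U x ≤ K * ‖x‖ ^ 2
  conj_right : ∀ x, conj (fun y => (k y : EReal)) x = (U x : EReal)
  conj_left : ∀ y, conj (fun x => (U x : EReal)) y = (k y : EReal)
  lower : ∃ C : ℝ≥0∞, C ≠ ⊤ ∧ ∀ y, ENNReal.ofReal (‖y‖ ^ 2) ≤ C * k y

lemma negLog_expNeg {u : E n → EReal} (hu : ∀ x, u x ≠ ⊥) : negLog (expNeg u) = u := by
  funext x
  have h : EReal.exp (-(u x)) ≠ ⊤ := by
    simpa [EReal.neg_eq_top_iff] using hu x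
  simp only [negLog, expNeg]
  rw [ENNReal.ofReal_toReal h]
  simp

lemma expNeg_coe (U : E n → ℝ) (x : E n) : expNeg (fun z => (U z : EReal)) x = Real.exp (-U x) := by
  simp only [expNeg]
  rw [← EReal.coe_neg, EReal.exp_coe, ENNReal.toReal_ofReal (Real.exp_pos _).le]

lemma conj_le_iff {u : E n → EReal} {y : E n} {c : EReal} :
    conj u y ≤ c ↔ ∀ x, ((⟪x, y⟫ : ℝ) : EReal) - u x ≤ c := iSup_le_iff

lemma le_conj (u : E n → EReal) (x y : E n) : ((⟪x, y⟫ : ℝ) : EReal) - u x ≤ conj u y :=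
  le_iSup (fun x : E n => ((⟪x, y⟫ : ℝ) : EReal) - u x) x

lemma conj_anti {u v : E n → EReal} (h : ∀ x, u x ≤ v x) (y : E n) : conj v y ≤ conj u y :=
  iSup_mono fun x => EReal.sub_le_sub le_rfl (h x)

lemma act_apply (A : Matrix (Fin n) (Fin n) ℝ) (x : E n) : act A x = WithLp.toLp 2 (A.mulVec x) :=
  rfl

@[simp] lemma act_one (x : E n) : act 1 x = x := by
  rw [act_apply, Matrix.one_mulVec]

lemma act_act (A B : Matrix (Fin n) (Fin n) ℝ) (x : E n) : act A (act B x) = act (A * B) x := by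
  simp only [act_apply, Matrix.mulVec_mulVec]

lemma inner_act_left (A : Matrix (Fin n) (Fin n) ℝ) (x y : E n) :
    ⟪act A.transpose x, y⟫ = ⟪x, act A y⟫ := by
  simp only [act_apply, EuclideanSpace.inner_eq_star_dotProduct, star_trivial,
    Matrix.mulVec_transpose]
  rw [dotProduct_comm, ← Matrix.dotProduct_mulVec, dotProduct_comm]

lemma supportFn_gaussian (φ : GL (Fin n) ℝ) (y : E n) :
    supportFn (gaussian φ) y = ((‖act (φ⁻¹).val.transpose y‖ ^ 2 / 2 : ℝ) : EReal) := by
  have h1 : negLog (gaussian φ) = fun x => ((‖act φ.val x‖ ^ 2 / 2 : ℝ) : EReal) := by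
    rw [← negLog_expNeg (u := fun x => ((‖act φ.val x‖ ^ 2 / 2 : ℝ) : EReal)) (by simp)]
    congr 1
    funext x
    rw [expNeg_coe]; rfl
  have hin : ∀ x : E n, ⟪x, y⟫ = ⟪act φ.val x, act (φ⁻¹).val.transpose y⟫ := by
    intro x
    rw [real_inner_comm, real_inner_comm (act _ _), inner_act_left, act_act,
      ← Matrix.GeneralLinearGroup.coe_mul]
    simp
  rw [supportFn, h1]
  apply le_antisymm
  · rw [conj_le_iff]
    intro x
    rw [← EReal.coe_sub, EReal.coe_le_coe_iff, hin]
    have := norm_sub_sq_real (act φ.val x) (act (φ⁻¹).val.transpose y)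
    nlinarith [sq_nonneg (‖act φ.val x - act (φ⁻¹).val.transpose y‖)]
  -- Completing the square shows that the supremum is attained where `φ x = φ^{-t} y`.
  · set w := act (φ⁻¹).val.transpose y with hw
    have hx : act φ.val (act (φ⁻¹).val w) = w := by
      rw [act_act, ← Matrix.GeneralLinearGroup.coe_mul]
      simp
    refine le_trans (le_of_eq ?_) (le_conj _ (act (φ⁻¹).val w) y)
    rw [← EReal.coe_sub, hin, hx, real_inner_self_eq_norm_sq]
    congr 1
    ring

lemma supportFn_gaussian_one (y : E n) :
    supportFn (gaussian (1 : GL (Fin n) ℝ)) y = ((‖y‖ ^ 2 / 2 : ℝ) : EReal) := by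
  rw [supportFn_gaussian]
  simp

/-- Once `U ≥ 1` on the sphere of radius `R`, convexity along rays from the origin forces `U x ≥ ‖x‖
/ R` outside it; the `-1` takes care of the ball. -/
lemma exists_linear_lower_bound {U : E n → ℝ} (hc : ConvexOn ℝ Set.univ U) (h0 : U 0 = 0)
    (hnn : ∀ x, 0 ≤ U x) (ht : Tendsto U (cocompact (E n)) atTop) :
    ∃ R : ℝ, 0 < R ∧ ∀ x, ‖x‖ / R - 1 ≤ U x := by
  have h1 := ht.eventually_ge_atTop 1
  rw [Filter.Eventually, Metric.mem_cocompact_iff_closedBall_compl_subset 0] at h1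
  obtain ⟨r, hr⟩ := h1
  refine ⟨max r 0 + 1, by positivity, fun x => ?_⟩
  set R := max r 0 + 1 with hR
  have hRpos : 0 < R := by positivity
  have hrR : r < R := by rw [hR]; linarith [le_max_left r 0]
  rcases lt_or_ge ‖x‖ R with h | h
  · have : ‖x‖ / R ≤ 1 := by rw [div_le_one hRpos]; exact h.le
    linarith [hnn x]
  · have hxpos : 0 < ‖x‖ := hRpos.trans_le h
    set s := R / ‖x‖ with hs
    have hs0 : 0 < s := by positivity
    have hs1 : s ≤ 1 := by rw [hs, div_le_one hxpos]; exact h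
    have hy : (1 : ℝ) ≤ U (s • x) := by
      apply hr
      simp only [Set.mem_compl_iff, Metric.mem_closedBall, dist_zero_right, not_le, norm_smul,
        Real.norm_eq_abs, abs_of_pos hs0]
      rw [hs, div_mul_cancel₀ _ hxpos.ne']
      exact hrR
    have h2 := hc.2 (Set.mem_univ (0 : E n)) (Set.mem_univ x) (sub_nonneg.2 hs1) hs0.le (by ring)
    simp only [smul_zero, zero_add, h0, smul_eq_mul, mul_zero] at h2
    have h3 : ‖x‖ / R = 1 / s := by rw [hs]; field_simp
    have h4 : 1 / s ≤ U x := by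
      rw [div_le_iff₀ hs0]; linarith
    linarith

theorem exists_convexPair {u : E n → EReal} (hu : u ∈ classL0 n)
    (hfin : normFirstVariationTop (expNeg u) (gaussian 1) < ⊤) :
    ∃ U : E n → ℝ, ∃ k : E n → ℝ≥0∞, u = (fun x => (U x : EReal)) ∧
      (∀ y, supportFn (expNeg u) y = k y) ∧ ConvexPair U k := by
  obtain ⟨⟨hbot, -, hcvx, htend⟩, hnn, hcc, h0⟩ := hu
  have hsupp : supportFn (expNeg u) = conj u := by rw [supportFn, negLog_expNeg hbot]
  have hk0 : ∀ y, 0 ≤ conj u y := fun y => by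
    have := le_conj u 0 y
    simpa [h0] using this
  set k : E n → ℝ≥0∞ := fun y => (conj u y).toENNReal with hk
  have hkc : ∀ y, (k y : EReal) = conj u y := fun y => EReal.coe_toENNReal (hk0 y)
  -- Adding `1` makes `S` nonzero, so that the quotient bound can be multiplied out even where `k y
  -- = ⊤`.
  set S := normFirstVariationTop (expNeg u) (gaussian 1) + 1 with hS
  have hStop : S ≠ ⊤ := by simpa [hS] using hfin.ne
  have hS0 : S ≠ 0 := by simp [hS]
  have hle : ∀ y, ENNReal.ofReal (‖y‖ ^ 2) ≤ (2 * S) * k y := by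
    intro y
    have h1 : ENNReal.ofReal (‖y‖ ^ 2 / 2) / k y ≤ S := by
      refine le_trans ?_ (le_self_add)
      refine le_trans (le_of_eq ?_) (le_iSup _ y)
      rw [supportFn_gaussian_one, hsupp, EReal.real_coe_toENNReal]
    have h2 := (ENNReal.div_le_iff_le_mul (Or.inr hStop) (Or.inr hS0)).1 h1
    calc ENNReal.ofReal (‖y‖ ^ 2) = 2 * ENNReal.ofReal (‖y‖ ^ 2 / 2) := by
          rw [two_mul, ← ENNReal.ofReal_add (by positivity) (by positivity), add_halves]
      _ ≤ 2 * (S * k y) := by gcongr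
      _ = _ := by ring
  set K : ℝ := (2 * S).toReal with hK
  have h2S : 2 * S ≠ ⊤ := ENNReal.mul_ne_top (by simp) hStop
  have hKpos : 0 < K := ENNReal.toReal_pos (by simpa using hS0) h2S
  have hquad : ∀ x, u x ≤ ((K * ‖x‖ ^ 2 : ℝ) : EReal) := by
    intro x
    rw [← hcc, conj_le_iff]
    intro y
    rw [← hkc y]
    by_cases hy : k y = ⊤
    · simp [hy]
    · have h3 := ENNReal.toReal_mono (ENNReal.mul_ne_top h2S hy) (hle y)
      rw [ENNReal.toReal_mul, ENNReal.toReal_ofReal (by positivity), ← hK] at h3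
      have h4 : (k y : EReal) = (((k y).toReal : ℝ) : EReal) := by
        rw [EReal.coe_ennreal_toReal hy]
      rw [h4, ← EReal.coe_sub, EReal.coe_le_coe_iff]
      have h5 : ⟪y, x⟫ ≤ ‖y‖ * ‖x‖ := real_inner_le_norm y x
      -- With `‖y‖² ≤ K k(y)` and division by `K`, this becomes `⟨y, x⟩ - k(y) ≤ K ‖x‖²`.
      have h6 : ‖y‖ * ‖x‖ * K ≤ K * K * ‖x‖ ^ 2 + ‖y‖ ^ 2 := by
        nlinarith [sq_nonneg (K * ‖x‖ - ‖y‖), sq_nonneg (K * ‖x‖), sq_nonneg ‖y‖]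
      have h7 : K * (‖y‖ * ‖x‖) ≤ K * ((k y).toReal + K * ‖x‖ ^ 2) := by nlinarith
      have h8 := le_of_mul_le_mul_left h7 hKpos
      linarith
  set U : E n → ℝ := fun x => (u x).toReal with hU
  have hutop : ∀ x, u x ≠ ⊤ := fun x => ne_of_lt ((hquad x).trans_lt (EReal.coe_lt_top _))
  have huU : ∀ x, (U x : EReal) = u x := fun x => EReal.coe_toReal (hutop x) (hbot x)
  have huU' : u = fun x => (U x : EReal) := funext fun x => (huU x).symm
  have hUc : ConvexOn ℝ Set.univ U := by
    refine ⟨convex_univ, ?_⟩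
    intro x _ y _ a b ha hb hab
    rcases ha.eq_or_lt with rfl | ha
    · have : b = 1 := by linarith
      simp [this]
    rcases hb.eq_or_lt with rfl | hb
    · have : a = 1 := by linarith
      simp [this]
    have := hcvx x y b hb (by linarith)
    have hab' : 1 - b = a := by linarith
    rw [hab', ← huU, ← huU, ← huU, ← EReal.coe_mul, ← EReal.coe_mul, ← EReal.coe_add,
      EReal.coe_le_coe_iff] at this
    exact this
  have hUnn : ∀ x, 0 ≤ U x := fun x => EReal.toReal_nonneg (hnn x)
  have hU0 : U 0 = 0 := by simp [hU, h0]
  refine ⟨U, k, huU', fun y => by rw [hsupp, hkc], hUc, hUnn, hU0, ?_, ⟨K, hKpos.le, ?_⟩, ?_, ?_,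
    ⟨2 * S, h2S, hle⟩⟩
  · apply exists_linear_lower_bound hUc hU0 hUnn
    rw [← EReal.tendsto_coe_nhds_top_iff]
    rw [huU'] at htend
    exact htend
  · intro x
    have := hquad x
    rwa [← huU, EReal.coe_le_coe_iff] at this
  · intro x
    rw [huU, show (fun y => (k y : EReal)) = conj u from funext hkc, hcc]
  · intro y
    rw [hkc, ← huU']

/-! ### Gradients of convex functions and integrability -/

lemma _root_.ConvexOn.add_inner_gradient_le {U : E n → ℝ} (hU : ConvexOn ℝ Set.univ U) {x g : E n}
    (hg : HasGradientAt U g x) (z : E n) : U x + ⟪g, z - x⟫ ≤ U z := by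
  have h1 := ((hasGradientAt_iff_hasFDerivAt.1 hg).hasLineDerivAt (z - x)).tendsto_slope_zero_right
  have h2 : ⟪g, z - x⟫ ≤ U z - U x := by
    refine le_of_tendsto (f := fun t : ℝ => t⁻¹ • (U (x + t • (z - x)) - U x)) (x := 𝓝[>] (0 : ℝ))
      (by simpa using h1) ?_
    have : Set.Ioc (0 : ℝ) 1 ∈ 𝓝[>] (0 : ℝ) := Ioc_mem_nhdsGT one_pos
    filter_upwards [this] with t ht
    have h3 := hU.2 (Set.mem_univ x) (Set.mem_univ z) (sub_nonneg.2 ht.2) ht.1.le (by ring)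
    have h4 : x + t • (z - x) = (1 - t) • x + t • z := by module
    rw [h4, smul_eq_mul, inv_mul_le_iff₀ ht.1]
    simp only [smul_eq_mul] at h3
    linarith
  linarith

/-- A finite convex function is Lipschitz on each ball, so Rademacher's theorem applies on a
countable exhaustion. -/
lemma _root_.ConvexOn.ae_differentiableAt {U : E n → ℝ} (hU : ConvexOn ℝ Set.univ U) :
    ∀ᵐ x, DifferentiableAt ℝ U x := by
  have hc : Continuous U := continuousOn_univ.1 (hU.continuousOn isOpen_univ)
  have h1 : ∀ N : ℕ, ∀ᵐ x : E n, x ∈ Metric.ball (0 : E n) N → DifferentiableAt ℝ U x := by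
    intro N
    obtain ⟨K, hK⟩ := (hU.subset (Set.subset_univ _) (convex_ball (0 : E n) (N + 1))
      ).exists_lipschitzOnWith_of_isBounded (r' := N) (by linarith)
      (((isCompact_closedBall (0 : E n) (N + 1)).image hc).isBounded.subset
        (Set.image_mono Metric.ball_subset_closedBall))
    filter_upwards [hK.ae_differentiableWithinAt_of_mem (μ := volume)] with x hx hxb
    exact (hx hxb).differentiableAt (Metric.isOpen_ball.mem_nhds hxb)
  filter_upwards [ae_all_iff.2 h1] with x hx
  obtain ⟨N, hN⟩ := exists_nat_gt ‖x‖
  exact hx N (by simpa using hN)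

lemma integrable_sq_mul_exp_neg_mul_norm {a : ℝ} (ha : 0 < a) :
    Integrable (fun x : E n => (1 + ‖x‖ ^ 2) * Real.exp (-(a * ‖x‖))) := by
  have hlim : Tendsto (fun r : ℝ => (1 + r) ^ (n + 3) * Real.exp (-a * r)) atTop (𝓝 0) := by
    have h1 := (Real.tendsto_pow_mul_exp_neg_atTop_nhds_zero (n + 3)).comp
      ((tendsto_const_nhds (x := a)).add_atTop (tendsto_id.const_mul_atTop ha))
    have h2 := h1.const_mul (Real.exp a / a ^ (n + 3))
    rw [mul_zero] at h2
    refine h2.congr fun r => ?_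
    simp only [Function.comp_apply, id]
    rw [show a + a * r = a * (1 + r) by ring, mul_pow, show -(a * (1 + r)) = -a + -a * r by ring,
      Real.exp_add, Real.exp_neg]
    field_simp
  obtain ⟨B, hB⟩ : ∃ B, ∀ r : ℝ, 0 ≤ r → (1 + r) ^ (n + 3) * Real.exp (-a * r) ≤ B := by
    obtain ⟨T, hT⟩ := eventually_atTop.1 (hlim.eventually_le_const one_pos)
    obtain ⟨B, hB⟩ := (isCompact_Icc (a := (0 : ℝ)) (b := max T 0)).bddAbove_image
      (f := fun r : ℝ => (1 + r) ^ (n + 3) * Real.exp (-a * r)) (by fun_prop)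
    refine ⟨max B 1, fun r hr => ?_⟩
    by_cases h : r ≤ max T 0
    · exact le_max_of_le_left (hB ⟨r, ⟨hr, h⟩, rfl⟩)
    · exact le_max_of_le_right (hT r ((le_max_left _ _).trans (not_le.1 h).le))
  have hint : Integrable (fun x : E n => (1 + ‖x‖) ^ (-((n : ℝ) + 1))) :=
    integrable_one_add_norm (by simp)
  refine (hint.const_mul B).mono' (by fun_prop) (Eventually.of_forall fun x => ?_)
  rw [Real.norm_of_nonneg (by positivity)]
  have h0 : 0 < 1 + ‖x‖ := by positivity
  have h1 := hB ‖x‖ (norm_nonneg x)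
  rw [Real.rpow_neg h0.le, show ((n : ℝ) + 1) = ((n + 1 : ℕ) : ℝ) by push_cast; ring,
    Real.rpow_natCast, ← div_eq_mul_inv, le_div_iff₀ (by positivity)]
  refine le_trans ?_ h1
  rw [neg_mul]
  have h2 : 1 + ‖x‖ ^ 2 ≤ (1 + ‖x‖) ^ 2 := by nlinarith [norm_nonneg x]
  calc _ = (1 + ‖x‖ ^ 2) * ((1 + ‖x‖) ^ (n + 1) * Real.exp (-(a * ‖x‖))) := by ring
    _ ≤ (1 + ‖x‖) ^ 2 * ((1 + ‖x‖) ^ (n + 1) * Real.exp (-(a * ‖x‖))) := by gcongr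
    _ = _ := by ring

namespace ConvexPair

variable {U : E n → ℝ} {k : E n → ℝ≥0∞} (P : ConvexPair U k)

include P

lemma continuous : Continuous U := continuousOn_univ.1 (P.convex.continuousOn isOpen_univ)

lemma young (x y : E n) : ((⟪x, y⟫ - U x : ℝ) : EReal) ≤ k y := by
  rw [← P.conj_left y, EReal.coe_sub]
  exact le_conj (fun x => (U x : EReal)) x y

lemma young_toReal {y : E n} (hy : k y ≠ ⊤) (x : E n) : ⟪x, y⟫ - U x ≤ (k y).toReal := by
  have := P.young x y
  rwa [← EReal.coe_ennreal_toReal hy, EReal.coe_le_coe_iff] at this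

lemma conj_zero : k 0 = 0 := by
  have h : conj (fun x => (U x : EReal)) 0 ≤ 0 := by
    rw [conj_le_iff]
    intro x
    rw [← EReal.coe_sub, ← EReal.coe_zero, EReal.coe_le_coe_iff]
    simpa using P.nonneg x
  rw [P.conj_left] at h
  exact le_antisymm (by exact_mod_cast h) bot_le

lemma inner_gradient_sub_nonneg {x g : E n} (hg : HasGradientAt U g x) : 0 ≤ ⟪x, g⟫ - U x := by
  have := P.convex.add_inner_gradient_le hg 0
  rw [P.zero, zero_sub, inner_neg_right, real_inner_comm] at this
  linarith

/-- Equality case of Young's inequality: the subgradient inequality says that `x` attains the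
supremum defining `k g`. -/
lemma conj_gradient {x g : E n} (hg : HasGradientAt U g x) :
    k g = ENNReal.ofReal (⟪x, g⟫ - U x) := by
  have h0 := P.inner_gradient_sub_nonneg hg
  have h : (k g : EReal) = ((⟪x, g⟫ - U x : ℝ) : EReal) := by
    refine le_antisymm ?_ (P.young x g)
    rw [← P.conj_left g, conj_le_iff]
    intro z
    rw [← EReal.coe_sub, EReal.coe_le_coe_iff]
    have := P.convex.add_inner_gradient_le hg z
    rw [inner_sub_right, real_inner_comm, real_inner_comm x] at this
    linarith
  rw [← EReal.toENNReal_coe (x := k g), h, EReal.real_coe_toENNReal]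

lemma exists_inner_gradient_sub_le : ∃ K : ℝ, 0 ≤ K ∧ ∀ x g, HasGradientAt U g x →
    ⟪x, g⟫ - U x ≤ K * ‖x‖ ^ 2 := by
  obtain ⟨K, hK, h⟩ := P.quad
  refine ⟨4 * K, by positivity, fun x g hg => ?_⟩
  -- Testing the subgradient at `2x` gives `⟨x, g⟩ ≤ U(2x) - U(x)`, and `U(2x)` is quadratically
  -- bounded.
  have h1 := P.convex.add_inner_gradient_le hg ((2 : ℝ) • x)
  have h2 : (2 : ℝ) • x - x = x := by module
  have h3 := h ((2 : ℝ) • x)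
  rw [norm_smul, Real.norm_ofNat] at h3
  rw [h2, real_inner_comm] at h1
  nlinarith [P.nonneg x]

/-- The function `2 U(x/2)` is the conjugate of `2k` and bounds all small perturbations of `U` from
below, so this is the dominating function for the first variation. -/
lemma integrable_sq_mul_exp_neg_half :
    Integrable (fun x => (1 + ‖x‖ ^ 2) * Real.exp (-(2 * U ((1 / 2 : ℝ) • x)))) := by
  obtain ⟨R, hR, h⟩ := P.coercive
  have hc := P.continuous
  refine ((integrable_sq_mul_exp_neg_mul_norm (n := n) (a := 1 / R) (by positivity)).const_mul
    (Real.exp 2)).mono' (by fun_prop) (Eventually.of_forall fun x => ?_)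
  rw [Real.norm_of_nonneg (by positivity), mul_left_comm, ← Real.exp_add]
  gcongr
  have := h ((1 / 2 : ℝ) • x)
  rw [norm_smul, Real.norm_of_nonneg (by norm_num)] at this
  have h2 : 1 / R * ‖x‖ = 2 * (1 / 2 * ‖x‖ / R) := by field_simp
  linarith

lemma two_mul_half_le (x : E n) : 2 * U ((1 / 2 : ℝ) • x) ≤ U x := by
  have := P.convex.2 (Set.mem_univ x) (Set.mem_univ (0 : E n)) (show (0 : ℝ) ≤ 1 / 2 by norm_num)
    (show (0 : ℝ) ≤ 1 / 2 by norm_num) (by norm_num)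
  rw [smul_zero, add_zero, P.zero] at this
  simp only [smul_eq_mul] at this
  linarith

lemma integrable_sq_mul_exp_neg :
    Integrable (fun x => (1 + ‖x‖ ^ 2) * Real.exp (-(U x))) := by
  have hc := P.continuous
  refine P.integrable_sq_mul_exp_neg_half.mono' (by fun_prop) (Eventually.of_forall fun x => ?_)
  rw [Real.norm_of_nonneg (by positivity)]
  gcongr
  exact P.two_mul_half_le x

lemma integrable_exp_neg : Integrable (fun x => Real.exp (-(U x))) := by
  have hc := P.continuous
  refine P.integrable_sq_mul_exp_neg.mono' (by fun_prop) (Eventually.of_forall fun x => ?_)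
  rw [Real.norm_of_nonneg (by positivity)]
  exact le_mul_of_one_le_left (Real.exp_pos _).le (by nlinarith [norm_nonneg x])

lemma hasGradientAt_ae : ∀ᵐ x, HasGradientAt U (gradient U x) x := by
  filter_upwards [P.convex.ae_differentiableAt] with x hx using hx.hasGradientAt

end ConvexPair

end LpJohn

noncomputable section

namespace LpJohn

variable {n : ℕ}

/-! ### `L_p` sums and approximate subgradients -/

lemma rpow_le_rpow_add_mul_sub {a b r : ℝ} (ha : 0 < a) (hb : 0 ≤ b) (hr0 : 0 ≤ r) (hr1 : r ≤ 1) :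
    b ^ r ≤ a ^ r + r * a ^ (r - 1) * (b - a) := by
  have h := rpow_one_add_le_one_add_mul_self (s := b / a - 1) (p := r)
    (by linarith [div_nonneg hb ha.le]) hr0 hr1
  rw [add_sub_cancel, Real.div_rpow hb ha.le, div_le_iff₀ (by positivity)] at h
  rw [Real.rpow_sub_one ha.ne']
  refine h.trans (le_of_eq ?_)
  field_simp

/-- The `L_p` sum `(k^p + t q^p)^{1/p}`. -/
def pSum (p : ℝ) (k : E n → ℝ≥0∞) (q : E n → ℝ) (t : ℝ) (y : E n) : ℝ≥0∞ :=
  (k y ^ p + ENNReal.ofReal t * ENNReal.ofReal (q y) ^ p) ^ (1 / p)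

lemma le_pSum {p : ℝ} (hp : 1 ≤ p) (k : E n → ℝ≥0∞) (q : E n → ℝ) (t : ℝ) (y : E n) :
    k y ≤ pSum p k q t y := by
  have hp0 : p ≠ 0 := by positivity
  calc k y = (k y ^ p) ^ (1 / p) := by rw [← ENNReal.rpow_mul, mul_one_div_cancel hp0, ENNReal.rpow_one]
    _ ≤ _ := ENNReal.rpow_le_rpow le_self_add (by positivity)

lemma pSum_le {p : ℝ} (hp : 1 ≤ p) {k : E n → ℝ≥0∞} {q : E n → ℝ} {t M : ℝ} (ht : 0 ≤ t) (hM : 0 ≤ M)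
    {y : E n} (h : ENNReal.ofReal (q y) ^ p ≤ ENNReal.ofReal M * k y ^ p) :
    pSum p k q t y ≤ ENNReal.ofReal (1 + t * M) * k y := by
  have hp0 : 0 < p := by positivity
  calc pSum p k q t y ≤ (k y ^ p + ENNReal.ofReal t * (ENNReal.ofReal M * k y ^ p)) ^ (1 / p) := by
        unfold pSum; gcongr
    _ = (ENNReal.ofReal (1 + t * M) * k y ^ p) ^ (1 / p) := by
        congr 1
        rw [ENNReal.ofReal_add (by norm_num) (by positivity), ENNReal.ofReal_mul ht, ENNReal.ofReal_one]
        ring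
    _ ≤ (ENNReal.ofReal (1 + t * M) ^ p * k y ^ p) ^ (1 / p) := by
        gcongr
        -- Replacing `1 + tM` by its `p`-th power costs precision but cancels the root, leaving a
        -- bound linear in `t`.
        have h1 : 1 ≤ ENNReal.ofReal (1 + t * M) := by
          rw [ENNReal.one_le_ofReal]; nlinarith [mul_nonneg ht hM]
        calc ENNReal.ofReal (1 + t * M) = ENNReal.ofReal (1 + t * M) ^ (1 : ℝ) := by simp
          _ ≤ _ := ENNReal.rpow_le_rpow_of_exponent_le h1 hp
    _ = _ := by
        rw [← ENNReal.mul_rpow_of_nonneg _ _ hp0.le, ← ENNReal.rpow_mul, mul_one_div_cancel hp0.ne',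
          ENNReal.rpow_one]

lemma pSum_ne_top {p : ℝ} (hp : 1 ≤ p) {k : E n → ℝ≥0∞} {q : E n → ℝ} {t M : ℝ} (ht : 0 ≤ t)
    (hM : 0 ≤ M) {y : E n} (hy : k y ≠ ⊤) (h : ENNReal.ofReal (q y) ^ p ≤ ENNReal.ofReal M * k y ^ p) :
    pSum p k q t y ≠ ⊤ :=
  ne_top_of_le_ne_top (ENNReal.mul_ne_top (by simp) hy) (pSum_le hp ht hM h)

lemma toReal_pSum {p : ℝ} (hp : 1 ≤ p) {k : E n → ℝ≥0∞} {q : E n → ℝ} (hq : ∀ y, 0 ≤ q y) {t : ℝ}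
    (ht : 0 ≤ t) {y : E n} (hy : k y ≠ ⊤) :
    (pSum p k q t y).toReal = ((k y).toReal ^ p + t * q y ^ p) ^ (1 / p) := by
  have hp0 : 0 ≤ p := by positivity
  rw [pSum, ← ENNReal.toReal_rpow, ENNReal.toReal_add, ← ENNReal.toReal_rpow, ENNReal.toReal_mul,
    ← ENNReal.toReal_rpow, ENNReal.toReal_ofReal ht, ENNReal.toReal_ofReal (hq y)]
  · exact ENNReal.rpow_ne_top_of_nonneg hp0 hy
  · exact ENNReal.mul_ne_top (by simp) (ENNReal.rpow_ne_top_of_nonneg hp0 (by simp))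

lemma measurable_conj_coe (k : E n → ℝ≥0∞) : Measurable (conj fun y => (k y : EReal)) := by
  have : LowerSemicontinuous (conj fun y => (k y : EReal)) := by
    apply lowerSemicontinuous_iSup
    intro y
    apply Continuous.lowerSemicontinuous
    by_cases hy : k y = ⊤
    · simp only [hy, EReal.coe_ennreal_top, EReal.sub_top]
      fun_prop
    · simp only [← EReal.coe_ennreal_toReal hy, ← EReal.coe_sub]
      exact continuous_coe_real_ereal.comp (by fun_prop)
  exact this.measurable

/-- If `y i` stayed at distance `η` from `g`, moving from `x` by `δ/2` in the direction `y i - g`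
would make the affine minorant exceed the first-order expansion of `U` by at least `δη/2`. The
differentiability error and `ε i` account for less than `δη/4` together. -/
lemma tendsto_of_approx_subgradient {ι : Type*} {l : Filter ι} {U : E n → ℝ} {x g : E n}
    (hg : HasGradientAt U g x) {y : ι → E n} {ε : ι → ℝ} (hε : Tendsto ε l (𝓝 0))
    (h : ∀ᶠ i in l, ∀ z, U x + ⟪z - x, y i⟫ - ε i ≤ U z) : Tendsto y l (𝓝 g) := by
  rw [Metric.tendsto_nhds]
  intro η hη
  have h1 := (hasGradientAt_iff_isLittleO.1 hg).def (c := η / 4) (by positivity)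
  rw [Metric.eventually_nhds_iff] at h1
  obtain ⟨δ, hδ, h1⟩ := h1
  have hε' : ∀ᶠ i in l, ε i < η / 4 * (δ / 2) := hε.eventually_lt_const (by positivity)
  filter_upwards [h, hε'] with i hi hεi
  by_contra! hcon
  rw [dist_eq_norm] at hcon
  set v := y i - g with hv
  have hvpos : 0 < ‖v‖ := hη.trans_le hcon
  set z := x + (δ / 2 / ‖v‖) • v with hz
  have hzx : z - x = (δ / 2 / ‖v‖) • v := by rw [hz]; abel
  have hnz : ‖z - x‖ = δ / 2 := by
    rw [hzx, norm_smul, Real.norm_of_nonneg (by positivity)]; field_simp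
  have h2 := h1 (y := z) (by rw [dist_eq_norm, hnz]; linarith)
  have h3 := hi z
  rw [hnz, Real.norm_eq_abs] at h2
  have h4 := (abs_le.1 h2).2
  have h5 : ⟪z - x, y i⟫ - ⟪g, z - x⟫ = δ / 2 * ‖v‖ := by
    rw [real_inner_comm (z - x) g, ← inner_sub_right, ← hv, hzx, inner_smul_left,
      real_inner_self_eq_norm_sq]
    simp only [conj_trivial]
    field_simp
  have h6 : δ / 2 * η ≤ δ / 2 * ‖v‖ := by gcongr
  nlinarith [mul_pos hδ hη]

/-! ### The first variation -/

namespace ConvexPair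

variable {U : E n → ℝ} {k : E n → ℝ≥0∞} (P : ConvexPair U k)
  {p : ℝ} (hp : 1 ≤ p) {q : E n → ℝ} (hq : ∀ y, 0 ≤ q y) (hqc : Continuous q) {M : ℝ} (hM : 0 ≤ M)
  (hqk : ∀ y, ENNReal.ofReal (q y) ^ p ≤ ENNReal.ofReal M * k y ^ p)

include P hp

lemma conj_pSum_le (t : ℝ) (x : E n) : conj (fun y => (pSum p k q t y : EReal)) x ≤ U x := by
  rw [← P.conj_right x]
  exact conj_anti (fun y => by exact_mod_cast le_pSum hp k q t y) x

include hq hqk in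
-- Domination by `k` kills `q` wherever `h_f(∇u) = 0`, so the value assigned to `0^{1-p}` never
-- matters.
lemma eq_zero_of_inner_gradient_sub_eq_zero {x g : E n} (hg : HasGradientAt U g x)
    (h : ⟪x, g⟫ - U x = 0) : q g = 0 := by
  have h1 := hqk g
  have hp0 : 0 < p := by positivity
  rw [P.conj_gradient hg, h, ENNReal.ofReal_zero, ENNReal.zero_rpow_of_pos hp0, mul_zero] at h1
  have h2 := (ENNReal.rpow_eq_zero_iff.1 (le_antisymm h1 bot_le))
  have : ENNReal.ofReal (q g) = 0 := by
    rcases h2 with h2 | h2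
    · exact h2.1
    · exact absurd h2.1 (by simp)
  exact le_antisymm (ENNReal.ofReal_eq_zero.1 this) (hq g)

include hM hqk

lemma conj_pSum_nonneg {t : ℝ} (ht : 0 ≤ t) (x : E n) :
    0 ≤ conj (fun y => (pSum p k q t y : EReal)) x := by
  have h0 : pSum p k q t 0 = 0 := by
    have := pSum_le hp ht hM (hqk 0)
    rw [P.conj_zero, mul_zero] at this
    exact le_antisymm this bot_le
  have := le_conj (fun y => (pSum p k q t y : EReal)) 0 x
  simpa [h0] using this

lemma coe_toReal_conj_pSum {t : ℝ} (ht : 0 ≤ t) (x : E n) :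
    (((conj (fun y => (pSum p k q t y : EReal)) x).toReal : ℝ) : EReal) =
      conj (fun y => (pSum p k q t y : EReal)) x :=
  EReal.coe_toReal (ne_of_lt ((P.conj_pSum_le hp t x).trans_lt (EReal.coe_lt_top _)))
    (ne_of_gt (lt_of_lt_of_le (EReal.bot_lt_zero) (P.conj_pSum_nonneg hp hM hqk ht x)))

lemma le_toReal_conj_pSum {t : ℝ} (ht : 0 ≤ t) {y : E n} (hy : k y ≠ ⊤) (x : E n) :
    ⟪x, y⟫ - (pSum p k q t y).toReal ≤ (conj (fun y => (pSum p k q t y : EReal)) x).toReal := by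
  have h := le_conj (fun y => (pSum p k q t y : EReal)) y x
  rw [← P.coe_toReal_conj_pSum hp hM hqk ht, ← EReal.coe_ennreal_toReal
    (pSum_ne_top hp ht hM hy (hqk y)), ← EReal.coe_sub, EReal.coe_le_coe_iff, real_inner_comm] at h
  exact h

lemma toReal_conj_pSum_le {t : ℝ} (ht : 0 ≤ t) (x : E n) :
    (conj (fun y => (pSum p k q t y : EReal)) x).toReal ≤ U x := by
  have h := P.conj_pSum_le hp (q := q) t x
  rwa [← P.coe_toReal_conj_pSum hp hM hqk ht, EReal.coe_le_coe_iff] at h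

/-- For `tM ≤ 1` the `L_p` sum is at most `2k`, and conjugation reverses order. The bound does not
depend on `t`. -/
lemma two_mul_half_le_toReal_conj_pSum {t : ℝ} (ht : 0 ≤ t) (htM : t * M ≤ 1) (x : E n) :
    2 * U ((1 / 2 : ℝ) • x) ≤ (conj (fun y => (pSum p k q t y : EReal)) x).toReal := by
  set V := (conj (fun y => (pSum p k q t y : EReal)) x).toReal with hV
  suffices h : conj (fun y => (k y : EReal)) ((1 / 2 : ℝ) • x) ≤ ((V / 2 : ℝ) : EReal) by
    rw [P.conj_right, EReal.coe_le_coe_iff] at h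
    linarith
  rw [conj_le_iff]
  intro y
  by_cases hy : k y = ⊤
  · simp [hy]
  rw [← EReal.coe_ennreal_toReal hy, ← EReal.coe_sub, EReal.coe_le_coe_iff]
  have h1 := P.le_toReal_conj_pSum hp hM hqk ht hy x
  have h2 := ENNReal.toReal_mono (ENNReal.mul_ne_top (by simp) hy) (pSum_le hp ht hM (hqk y))
  rw [ENNReal.toReal_mul, ENNReal.toReal_ofReal (by positivity)] at h2
  rw [inner_smul_right, real_inner_comm]
  nlinarith [ENNReal.toReal_nonneg (a := k y), hV]

lemma sub_toReal_conj_pSum_le_mul {t : ℝ} (ht : 0 ≤ t) {x g : E n} (hg : HasGradientAt U g x) :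
    U x - (conj (fun y => (pSum p k q t y : EReal)) x).toReal ≤ t * (M * (⟪x, g⟫ - U x)) := by
  have hk := P.conj_gradient hg
  have hk' : k g ≠ ⊤ := by simp [hk]
  have h1 := P.le_toReal_conj_pSum hp hM hqk ht hk' x
  have h2 := ENNReal.toReal_mono (ENNReal.mul_ne_top (by simp) hk') (pSum_le hp ht hM (hqk g))
  rw [ENNReal.toReal_mul, ENNReal.toReal_ofReal (by positivity), hk,
    ENNReal.toReal_ofReal (P.inner_gradient_sub_nonneg hg)] at h2
  nlinarith

include hq

lemma sub_toReal_conj_pSum_le {t : ℝ} (ht : 0 ≤ t) {x g : E n} (hg : HasGradientAt U g x) :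
    U x - (conj (fun y => (pSum p k q t y : EReal)) x).toReal ≤
      ((⟪x, g⟫ - U x) ^ p + t * q g ^ p) ^ (1 / p) - (⟪x, g⟫ - U x) := by
  have hk := P.conj_gradient hg
  have hk' : k g ≠ ⊤ := by simp [hk]
  have h1 := P.le_toReal_conj_pSum hp hM hqk ht hk' x
  rw [toReal_pSum hp hq ht hk', hk, ENNReal.toReal_ofReal (P.inner_gradient_sub_nonneg hg)] at h1
  linarith

include hqc

/-- An envelope argument. Testing the supremum at `y = g` bounds the quotient from above. From
below, near-maximizers `y t` are approximate subgradients of `U` at `x`, hence tend to `g`, and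
concavity of the `1/p`-th power bounds the quotient in terms of `y t`. -/
lemma tendsto_sub_conj_pSum_div {x g : E n} (hg : HasGradientAt U g x) :
    Tendsto (fun t : ℝ => (U x - (conj (fun y => (pSum p k q t y : EReal)) x).toReal) / t) (𝓝[>] 0)
      (𝓝 (1 / p * (q g ^ p * (⟪x, g⟫ - U x) ^ (1 - p)))) := by
  have hp0 : 0 < p := by positivity
  set κ := ⟪x, g⟫ - U x with hκ
  have hκ0 : 0 ≤ κ := P.inner_gradient_sub_nonneg hg
  set V : ℝ → ℝ := fun t => (conj (fun y => (pSum p k q t y : EReal)) x).toReal with hV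
  have hpos : ∀ᶠ t : ℝ in 𝓝[>] 0, 0 < t := eventually_mem_nhdsWithin
  rcases hκ0.eq_or_lt with hκz | hκpos
  · have hqz : q g = 0 := P.eq_zero_of_inner_gradient_sub_eq_zero hp hq hqk hg hκz.symm
    rw [hqz, Real.zero_rpow hp0.ne', zero_mul, mul_zero]
    refine tendsto_const_nhds.congr' ?_
    filter_upwards [hpos] with t ht
    have h1 := P.sub_toReal_conj_pSum_le_mul hp hM hqk ht.le hg
    have h2 := P.toReal_conj_pSum_le hp hM hqk ht.le x
    rw [← hκ, ← hκz] at h1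
    have : U x - V t = 0 := by simp only [hV]; nlinarith
    change 0 = (U x - V t) / t
    rw [this, zero_div]
  have hVle : ∀ t, 0 < t → V t ≤ U x := fun t ht => P.toReal_conj_pSum_le hp hM hqk ht.le x
  have hVlim : Tendsto V (𝓝[>] 0) (𝓝 (U x)) := by
    have h0 : Tendsto (fun t : ℝ => U x - t * (M * κ)) (𝓝[>] 0) (𝓝 (U x)) := by
      have : Tendsto (fun t : ℝ => U x - t * (M * κ)) (𝓝 0) (𝓝 (U x - 0 * (M * κ))) :=
        Continuous.tendsto (by fun_prop) 0
      rw [zero_mul, sub_zero] at this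
      exact this.mono_left nhdsWithin_le_nhds
    refine tendsto_of_tendsto_of_tendsto_of_le_of_le' h0 tendsto_const_nhds ?_ ?_
    · filter_upwards [hpos] with t ht
      linarith [P.sub_toReal_conj_pSum_le_mul hp hM hqk ht.le hg]
    · filter_upwards [hpos] with t ht using hVle t ht
  -- The slack `t²` is still negligible after division by `t`.
  have hex : ∀ t : ℝ, ∃ y : E n, 0 < t → k y ≠ ⊤ ∧
      V t - t ^ 2 < ⟪x, y⟫ - ((k y).toReal ^ p + t * q y ^ p) ^ (1 / p) := by
    intro t
    by_cases ht : 0 < t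
    · have h1 : ((V t - t ^ 2 : ℝ) : EReal) < conj (fun y => (pSum p k q t y : EReal)) x := by
        rw [← P.coe_toReal_conj_pSum hp hM hqk ht.le, EReal.coe_lt_coe_iff]
        simp only [hV]
        nlinarith [pow_pos ht 2]
      obtain ⟨y, hy⟩ := lt_iSup_iff.1 h1
      have hyt : k y ≠ ⊤ := by
        intro h
        have : pSum p k q t y = ⊤ := top_le_iff.1 (h ▸ le_pSum hp k q t y)
        simp [this] at hy
      refine ⟨y, fun _ => ⟨hyt, ?_⟩⟩
      simp only [← EReal.coe_ennreal_toReal (pSum_ne_top hp ht.le hM hyt (hqk y))] at hy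
      rw [← EReal.coe_sub, EReal.coe_lt_coe_iff, toReal_pSum hp hq ht.le hyt, real_inner_comm] at hy
      exact hy
    · exact ⟨0, fun h => absurd h ht⟩
  choose y hy using hex
  set a : ℝ → ℝ := fun t => (k (y t)).toReal with ha
  have hale : ∀ t, 0 < t → a t ≤ (a t ^ p + t * q (y t) ^ p) ^ (1 / p) := by
    intro t ht
    have ha0 : 0 ≤ a t := ENNReal.toReal_nonneg
    calc a t = (a t ^ p) ^ (1 / p) := by
          rw [← Real.rpow_mul ha0, mul_one_div_cancel hp0.ne', Real.rpow_one]
      _ ≤ _ := Real.rpow_le_rpow (by positivity)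
          (le_add_of_nonneg_right (mul_nonneg ht.le (Real.rpow_nonneg (hq _) _))) (by positivity)
  have hsq : Tendsto (fun t : ℝ => t ^ 2) (𝓝[>] 0) (𝓝 0) := by
    have : Tendsto (fun t : ℝ => t ^ 2) (𝓝 0) (𝓝 (0 ^ 2)) := Continuous.tendsto (by fun_prop) 0
    rw [zero_pow two_ne_zero] at this
    exact this.mono_left nhdsWithin_le_nhds
  have hylim : Tendsto y (𝓝[>] 0) (𝓝 g) := by
    refine tendsto_of_approx_subgradient hg (ε := fun t => U x - V t + t ^ 2) ?_ ?_
    · have := (hVlim.const_sub (U x)).add hsq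
      simpa using this
    · filter_upwards [hpos] with t ht z
      have h1 := (hy t ht).2
      have h2 := P.young_toReal (hy t ht).1 z
      have h3 := hale t ht
      rw [inner_sub_left]
      simp only [ha] at h3
      linarith
  have hinner : Tendsto (fun t => ⟪x, y t⟫) (𝓝[>] 0) (𝓝 ⟪x, g⟫) := tendsto_const_nhds.inner hylim
  have halim : Tendsto a (𝓝[>] 0) (𝓝 κ) := by
    refine tendsto_of_tendsto_of_tendsto_of_le_of_le' (hinner.sub_const (U x))
      (h := fun t => ⟪x, y t⟫ - V t + t ^ 2) ?_ ?_ ?_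
    · have := (hinner.sub hVlim).add hsq
      simpa using this
    · filter_upwards [hpos] with t ht using P.young_toReal (hy t ht).1 x
    · filter_upwards [hpos] with t ht
      have h1 := (hy t ht).2
      have h3 := hale t ht
      simp only [ha] at h3 ⊢
      linarith
  have hqlim : Tendsto (fun t => q (y t) ^ p) (𝓝[>] 0) (𝓝 (q g ^ p)) :=
    ((hqc.tendsto g).comp hylim).rpow_const (Or.inr hp0.le)
  have htlim : Tendsto (fun t : ℝ => t) (𝓝[>] 0) (𝓝 0) := tendsto_id.mono_left nhdsWithin_le_nhds
  have hblim : Tendsto (fun t => a t ^ p + t * q (y t) ^ p) (𝓝[>] 0) (𝓝 (κ ^ p)) := by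
    have := (halim.rpow_const (p := p) (Or.inl hκpos.ne')).add (htlim.mul hqlim)
    simpa using this
  have hexp : (κ ^ p) ^ (1 / p - 1) = κ ^ (1 - p) := by
    rw [← Real.rpow_mul hκ0]; congr 1; field_simp
  -- The tangent of the root is taken at the perturbed point `a^p + t q^p`, since concavity then
  -- bounds the increment from below.
  have hlow : Tendsto (fun t => 1 / p * (a t ^ p + t * q (y t) ^ p) ^ (1 / p - 1) * q (y t) ^ p - t)
      (𝓝[>] 0) (𝓝 (1 / p * (q g ^ p * κ ^ (1 - p)))) := by
    have h1 := (((hblim.rpow_const (p := 1 / p - 1) (Or.inl (by positivity))).const_mul (1 / p)).mul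
      hqlim).sub htlim
    rw [hexp, sub_zero] at h1
    convert h1 using 2
    ring
  have hr0 : 0 ≤ 1 / p := by positivity
  have hr1 : 1 / p ≤ 1 := by rw [div_le_one hp0]; exact hp
  refine tendsto_of_tendsto_of_tendsto_of_le_of_le' hlow tendsto_const_nhds ?_ ?_
  · filter_upwards [hpos, halim.eventually_const_lt hκpos] with t ht hat
    have hb : 0 < a t ^ p + t * q (y t) ^ p :=
      add_pos_of_pos_of_nonneg (by positivity) (mul_nonneg ht.le (Real.rpow_nonneg (hq _) _))
    have h1 := rpow_le_rpow_add_mul_sub hb (b := a t ^ p) (by positivity) hr0 hr1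
    rw [← Real.rpow_mul hat.le, mul_one_div_cancel hp0.ne', Real.rpow_one] at h1
    have h2 := (hy t ht).2
    have h3 := P.young_toReal (hy t ht).1 x
    rw [le_div_iff₀ ht]
    simp only [ha, hV] at h1 h2 h3 ⊢
    nlinarith
  · filter_upwards [hpos] with t ht
    have h1 := P.sub_toReal_conj_pSum_le hp hq hM hqk ht.le hg
    have h2 := rpow_le_rpow_add_mul_sub (a := κ ^ p) (b := κ ^ p + t * q g ^ p) (by positivity)
      (add_nonneg (by positivity) (mul_nonneg ht.le (Real.rpow_nonneg (hq _) _))) hr0 hr1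
    rw [hexp, ← Real.rpow_mul hκ0, mul_one_div_cancel hp0.ne', Real.rpow_one] at h2
    rw [div_le_iff₀ ht]
    rw [← hκ] at h1
    nlinarith

theorem tendsto_integral_expNeg_conj_pSum :
    Tendsto (fun t : ℝ => (J (expNeg (conj fun y => (pSum p k q t y : EReal)))
        - ∫ x, Real.exp (-(U x))) / t) (𝓝[>] 0)
      (𝓝 (∫ x, Real.exp (-(U x)) * (1 / p * (q (gradient U x) ^ p *
        (⟪x, gradient U x⟫ - U x) ^ (1 - p))))) := by
  obtain ⟨K, hK, hKle⟩ := P.exists_inner_gradient_sub_le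
  set V : ℝ → E n → ℝ := fun t x => (conj (fun y => (pSum p k q t y : EReal)) x).toReal with hV
  have hpos : ∀ᶠ t : ℝ in 𝓝[>] 0, 0 < t := eventually_mem_nhdsWithin
  have hMlim : ∀ᶠ t : ℝ in 𝓝[>] 0, t * M < 1 := by
    have : Tendsto (fun t : ℝ => t * M) (𝓝 0) (𝓝 (0 * M)) := Continuous.tendsto (by fun_prop) 0
    rw [zero_mul] at this
    exact (this.mono_left nhdsWithin_le_nhds).eventually_lt_const one_pos
  have hVm : ∀ t, Measurable (V t) := fun t => (measurable_conj_coe _).ereal_toReal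
  have hJ : ∀ t : ℝ, 0 < t →
      J (expNeg (conj fun y => (pSum p k q t y : EReal))) = ∫ x, Real.exp (-(V t x)) := by
    intro t ht
    rw [J]
    congr 1
    funext x
    rw [← expNeg_coe]
    simp only [expNeg, hV]
    rw [P.coe_toReal_conj_pSum hp hM hqk ht.le]
  have hVint : ∀ t : ℝ, 0 < t → t * M < 1 → Integrable (fun x => Real.exp (-(V t x))) := by
    intro t ht htM
    refine P.integrable_sq_mul_exp_neg_half.mono'
      ((hVm t).neg.exp.aestronglyMeasurable) (Eventually.of_forall fun x => ?_)
    rw [Real.norm_of_nonneg (Real.exp_pos _).le]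
    have h1 := P.two_mul_half_le_toReal_conj_pSum hp hM hqk ht.le htM.le x
    refine le_trans (Real.exp_le_exp.2 (neg_le_neg h1)) ?_
    exact le_mul_of_one_le_left (Real.exp_pos _).le (by nlinarith [norm_nonneg x])
  have key : Tendsto (fun t : ℝ => ∫ x, (Real.exp (-(V t x)) - Real.exp (-(U x))) / t) (𝓝[>] 0)
      (𝓝 (∫ x, Real.exp (-(U x)) * (1 / p * (q (gradient U x) ^ p *
        (⟪x, gradient U x⟫ - U x) ^ (1 - p))))) := by
    refine tendsto_integral_filter_of_dominated_convergence
      (fun x => M * K * ((1 + ‖x‖ ^ 2) * Real.exp (-(2 * U ((1 / 2 : ℝ) • x))))) ?_ ?_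
      (P.integrable_sq_mul_exp_neg_half.const_mul _) ?_
    · refine Eventually.of_forall fun t => ?_
      have := P.continuous.measurable
      have := hVm t
      exact Measurable.aestronglyMeasurable (by fun_prop)
    · filter_upwards [hpos, hMlim] with t ht htM
      filter_upwards [P.hasGradientAt_ae] with x hx
      have h1 := P.sub_toReal_conj_pSum_le_mul hp hM hqk ht.le hx
      have h2 := P.toReal_conj_pSum_le hp hM hqk ht.le x
      have h3 := P.two_mul_half_le_toReal_conj_pSum hp hM hqk ht.le htM.le x
      have h4 := hKle x _ hx
      have h0 := P.inner_gradient_sub_nonneg hx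
      change U x - V t x ≤ _ at h1
      change V t x ≤ _ at h2
      change _ ≤ V t x at h3
      rw [Real.norm_of_nonneg (div_nonneg (sub_nonneg.2 (Real.exp_le_exp.2 (neg_le_neg h2))) ht.le),
        div_le_iff₀ ht]
      have h5 : Real.exp (-(V t x)) - Real.exp (-(U x)) ≤ Real.exp (-(V t x)) * (U x - V t x) := by
        have h6 : Real.exp (-(U x)) = Real.exp (-(V t x)) * Real.exp (-(U x - V t x)) := by
          rw [← Real.exp_add]; congr 1; ring
        rw [h6]
        nlinarith [Real.add_one_le_exp (-(U x - V t x)), Real.exp_pos (-(V t x))]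
      have h7 : U x - V t x ≤ t * (M * (K * (1 + ‖x‖ ^ 2))) := by
        refine h1.trans ?_
        gcongr
        nlinarith [h4]
      calc _ ≤ Real.exp (-(V t x)) * (U x - V t x) := h5
        _ ≤ Real.exp (-(2 * U ((1 / 2 : ℝ) • x))) * (t * (M * (K * (1 + ‖x‖ ^ 2)))) := by
          gcongr
        _ = _ := by ring
    · filter_upwards [P.hasGradientAt_ae] with x hx
      have h1 := P.tendsto_sub_conj_pSum_div hp hq hqc hM hqk hx
      change Tendsto (fun t => (U x - V t x) / t) _ _ at h1
      have h2 : Tendsto (fun t => U x - V t x) (𝓝[>] 0) (𝓝 0) := by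
        have := (tendsto_id.mono_left nhdsWithin_le_nhds : Tendsto (fun t : ℝ => t) (𝓝[>] 0) (𝓝 0)).mul h1
        rw [zero_mul] at this
        refine this.congr' ?_
        filter_upwards [hpos] with t ht
        exact mul_div_cancel₀ _ ht.ne'
      have h3 : Tendsto (fun t => (U x - V t x) / t * Real.exp (U x - V t x)) (𝓝[>] 0)
          (𝓝 (1 / p * (q (gradient U x) ^ p * (⟪x, gradient U x⟫ - U x) ^ (1 - p)))) := by
        have := h1.mul ((Real.continuous_exp.tendsto 0).comp h2)
        simpa using this
      -- Squeeze by `s ≤ e^s - 1 ≤ s e^s` with `s = U x - V t x`.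
      have h4 : Tendsto (fun t => (Real.exp (U x - V t x) - 1) / t) (𝓝[>] 0)
          (𝓝 (1 / p * (q (gradient U x) ^ p * (⟪x, gradient U x⟫ - U x) ^ (1 - p)))) := by
        refine tendsto_of_tendsto_of_tendsto_of_le_of_le' h1 h3 ?_ ?_
        · filter_upwards [hpos] with t ht
          refine div_le_div_of_nonneg_right ?_ ht.le
          linarith [Real.add_one_le_exp (U x - V t x)]
        · filter_upwards [hpos] with t ht
          rw [div_mul_eq_mul_div]
          refine div_le_div_of_nonneg_right ?_ ht.le
          have h5 := Real.add_one_le_exp (-(U x - V t x))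
          have h6 : Real.exp (-(U x - V t x)) * Real.exp (U x - V t x) = 1 := by
            rw [← Real.exp_add]; simp
          nlinarith [Real.exp_pos (U x - V t x)]
      refine (h4.const_mul (Real.exp (-(U x)))).congr fun t => ?_
      rw [mul_div_assoc', mul_sub, ← Real.exp_add, mul_one]
      congr 3
      ring
  refine key.congr' ?_
  filter_upwards [hpos, hMlim] with t ht htM
  rw [integral_div, integral_sub (hVint t ht htM) P.integrable_exp_neg, hJ t ht]

end ConvexPair

/-! ### The mass `J(f^⋄)` -/

lemma measurable_gradient (U : E n → ℝ) : Measurable (gradient U) := by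
  unfold gradient
  exact (LinearIsometryEquiv.continuous _).measurable.comp (measurable_fderiv ℝ U)

namespace ConvexPair

variable {U : E n → ℝ} {k : E n → ℝ≥0∞} (P : ConvexPair U k)

include P

lemma sub_le_mul_of_smul {t : ℝ} (ht0 : 0 ≤ t) (ht1 : t ≤ 1) (x : E n) :
    U ((1 + t) • x) - U x ≤ t * U ((2 : ℝ) • x) := by
  have h := P.convex.2 (Set.mem_univ x) (Set.mem_univ ((2 : ℝ) • x)) (sub_nonneg.2 ht1) ht0 (by ring)
  have h1 : (1 - t) • x + t • (2 : ℝ) • x = (1 + t) • x := by module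
  rw [h1] at h
  simp only [smul_eq_mul] at h
  nlinarith [P.nonneg x, mul_nonneg ht0 (P.nonneg x)]

lemma le_smul {t : ℝ} (ht0 : 0 ≤ t) (x : E n) : U x ≤ U ((1 + t) • x) := by
  have h1t : 0 < 1 + t := by linarith
  have h := P.convex.2 (Set.mem_univ (0 : E n)) (Set.mem_univ ((1 + t) • x))
    (show 0 ≤ t / (1 + t) by positivity) (show 0 ≤ 1 / (1 + t) by positivity) (by field_simp; ring)
  have h1 : (t / (1 + t)) • (0 : E n) + (1 / (1 + t)) • (1 + t) • x = x := by
    rw [smul_zero, zero_add, smul_smul, one_div_mul_cancel h1t.ne', one_smul]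
  rw [h1, P.zero] at h
  simp only [smul_eq_mul, mul_zero, zero_add] at h
  have h2 : 1 / (1 + t) ≤ 1 := by rw [div_le_one h1t]; linarith
  nlinarith [P.nonneg ((1 + t) • x)]

/-- Both sides come from the right derivative at `t = 0` of `∫ e^{-U((1+t)x)} dx = (1+t)^{-n} ∫
e^{-U}`. Dilation replaces the divergence theorem, so no boundary term has to be controlled. -/
lemma integral_inner_gradient_mul :
    ∫ x, Real.exp (-(U x)) * ⟪x, gradient U x⟫ = n * ∫ x, Real.exp (-(U x)) := by
  obtain ⟨K, hK, hKle⟩ := P.quad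
  have hc := P.continuous
  have hpos : ∀ᶠ t : ℝ in 𝓝[>] 0, 0 < t := eventually_mem_nhdsWithin
  have hle1 : ∀ᶠ t : ℝ in 𝓝[>] 0, t ≤ 1 := by
    filter_upwards [Ioc_mem_nhdsGT (one_pos : (0 : ℝ) < 1)] with t ht using ht.2
  have key : Tendsto (fun t : ℝ => ∫ x, (Real.exp (-(U ((1 + t) • x))) - Real.exp (-(U x))) / t)
      (𝓝[>] 0) (𝓝 (∫ x, -(Real.exp (-(U x)) * ⟪x, gradient U x⟫))) := by
    refine tendsto_integral_filter_of_dominated_convergence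
      (fun x => 4 * K * ((1 + ‖x‖ ^ 2) * Real.exp (-(U x)))) ?_ ?_
      (P.integrable_sq_mul_exp_neg.const_mul _) ?_
    · exact Eventually.of_forall fun t => Continuous.aestronglyMeasurable (by fun_prop)
    · filter_upwards [hpos, hle1] with t ht ht1
      refine Eventually.of_forall fun x => ?_
      have h1 := P.sub_le_mul_of_smul ht.le ht1 x
      have h2 := P.le_smul ht.le x
      have h3 := hKle ((2 : ℝ) • x)
      rw [norm_smul, Real.norm_ofNat] at h3
      rw [Real.norm_eq_abs, abs_div, abs_of_pos ht, div_le_iff₀ ht, abs_sub_comm, abs_of_nonneg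
        (sub_nonneg.2 (Real.exp_le_exp.2 (neg_le_neg h2)))]
      have h5 : Real.exp (-(U x)) - Real.exp (-(U ((1 + t) • x))) ≤
          Real.exp (-(U x)) * (U ((1 + t) • x) - U x) := by
        have h6 : Real.exp (-(U ((1 + t) • x))) =
            Real.exp (-(U x)) * Real.exp (-(U ((1 + t) • x) - U x)) := by
          rw [← Real.exp_add]; congr 1; ring
        rw [h6]
        nlinarith [Real.add_one_le_exp (-(U ((1 + t) • x) - U x)), Real.exp_pos (-(U x))]
      have h7 : U ((1 + t) • x) - U x ≤ t * (4 * K * (1 + ‖x‖ ^ 2)) := by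
        refine h1.trans ?_
        gcongr
        nlinarith
      calc _ ≤ Real.exp (-(U x)) * (U ((1 + t) • x) - U x) := h5
        _ ≤ Real.exp (-(U x)) * (t * (4 * K * (1 + ‖x‖ ^ 2))) := by gcongr
        _ = _ := by ring
    · filter_upwards [P.hasGradientAt_ae] with x hx
      have h1 : HasFDerivAt (fun z => Real.exp (-(U z))) _ x :=
        ((hasGradientAt_iff_hasFDerivAt.1 hx).neg).exp
      have h2 := (h1.hasLineDerivAt x).tendsto_slope_zero_right
      have h3 : ⟪gradient U x, x⟫ = ⟪x, gradient U x⟫ := real_inner_comm _ _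
      simp only [_root_.smul_apply, _root_.neg_apply, smul_eq_mul,
        InnerProductSpace.toDual_apply_apply, h3, mul_neg] at h2
      refine h2.congr fun t => ?_
      rw [add_smul, one_smul, div_eq_inv_mul]
  have hint : ∀ t : ℝ, 0 < t → Integrable (fun x => Real.exp (-(U ((1 + t) • x)))) := by
    intro t ht
    exact P.integrable_exp_neg.comp_smul (by positivity)
  have hval : ∀ t : ℝ, 0 < t → ∫ x, (Real.exp (-(U ((1 + t) • x))) - Real.exp (-(U x))) / t =
      t⁻¹ * ((((1 + t) ^ n)⁻¹ - ((1 + 0) ^ n)⁻¹) * ∫ x, Real.exp (-(U x))) := by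
    intro t ht
    rw [integral_div, integral_sub (hint t ht) P.integrable_exp_neg,
      Measure.integral_comp_smul volume (fun x => Real.exp (-(U x))) (1 + t), finrank_euclideanSpace,
      Fintype.card_fin, smul_eq_mul, abs_of_nonneg (by positivity), add_zero, one_pow, inv_one]
    field_simp
  have hder : HasDerivAt (fun t : ℝ => ((1 + t) ^ n)⁻¹) (-n) 0 := by
    have h1 : HasDerivAt (fun t : ℝ => (1 + t) ^ n) n 0 := by
      have := ((hasDerivAt_id (0 : ℝ)).const_add 1).fun_pow n
      simpa using this
    have := h1.fun_inv (by simp)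
    simpa using this
  have hlim : Tendsto (fun t : ℝ => t⁻¹ * ((((1 + t) ^ n)⁻¹ - ((1 + 0) ^ n)⁻¹) *
      ∫ x, Real.exp (-(U x)))) (𝓝[>] 0) (𝓝 (-n * ∫ x, Real.exp (-(U x)))) := by
    have := (hder.tendsto_slope_zero_right).mul_const (∫ x, Real.exp (-(U x)))
    simpa [mul_assoc] using this
  have hlim2 := key.congr' (by filter_upwards [hpos] with t ht using hval t ht)
  have := tendsto_nhds_unique hlim hlim2
  rw [integral_neg] at this
  linarith

lemma integrable_inner_gradient_sub :
    Integrable (fun x => Real.exp (-(U x)) * (⟪x, gradient U x⟫ - U x)) := by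
  obtain ⟨K, hK, hKle⟩ := P.exists_inner_gradient_sub_le
  have hm := measurable_gradient U
  have hc := P.continuous.measurable
  refine (P.integrable_sq_mul_exp_neg.const_mul K).mono'
    (Measurable.aestronglyMeasurable (by fun_prop)) ?_
  filter_upwards [P.hasGradientAt_ae] with x hx
  rw [Real.norm_of_nonneg (mul_nonneg (Real.exp_pos _).le (P.inner_gradient_sub_nonneg hx))]
  have h1 := hKle x _ hx
  have h2 : ⟪x, gradient U x⟫ - U x ≤ K * (1 + ‖x‖ ^ 2) := by nlinarith
  calc _ ≤ Real.exp (-(U x)) * (K * (1 + ‖x‖ ^ 2)) := by gcongr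
    _ = _ := by ring

lemma integrable_mul_exp_neg : Integrable (fun x => U x * Real.exp (-(U x))) := by
  obtain ⟨K, hK, hKle⟩ := P.quad
  have hc := P.continuous
  refine (P.integrable_sq_mul_exp_neg.const_mul K).mono' (by fun_prop)
    (Eventually.of_forall fun x => ?_)
  rw [Real.norm_of_nonneg (mul_nonneg (P.nonneg x) (Real.exp_pos _).le), ← mul_assoc]
  gcongr
  nlinarith [hKle x]

lemma diamondMass_eq : diamondMass (fun x => Real.exp (-(U x))) =
    ∫ x, Real.exp (-(U x)) * (⟪x, gradient U x⟫ - U x) := by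
  have h1 : Integrable (fun x => Real.exp (-(U x)) * ⟪x, gradient U x⟫) := by
    refine (P.integrable_inner_gradient_sub.add P.integrable_mul_exp_neg).congr
      (Eventually.of_forall fun x => ?_)
    simp only [Pi.add_apply]; ring
  simp only [diamondMass, J, Real.log_exp]
  have h2 : (fun x => (n : ℝ) * Real.exp (-(U x)) + Real.exp (-(U x)) * -(U x)) =
      fun x => (n : ℝ) * Real.exp (-(U x)) - U x * Real.exp (-(U x)) := by
    funext x; ring
  have h3 : (fun x => Real.exp (-(U x)) * (⟪x, gradient U x⟫ - U x)) =
      fun x => Real.exp (-(U x)) * ⟪x, gradient U x⟫ - U x * Real.exp (-(U x)) := by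
    funext x; ring
  rw [h2, h3, integral_sub (P.integrable_exp_neg.const_mul _) P.integrable_mul_exp_neg,
    integral_sub h1 P.integrable_mul_exp_neg, integral_const_mul, P.integral_inner_gradient_mul]

/-- Otherwise the subgradient inequality and continuity would give `U x ≤ U (x - s v)` for all `x`,
hence `U (s v) ≤ U 0 = 0`, against coercivity. -/
lemma not_ae_inner_gradient_eq_zero {v : E n} (hv : v ≠ 0) :
    ¬ ∀ᵐ x, ⟪v, gradient U x⟫ = 0 := by
  intro h
  obtain ⟨R, hR, hco⟩ := P.coercive
  -- Chosen so that the coercive lower bound at `s v` equals `2 - 1 > 0`.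
  set s : ℝ := 2 * R / ‖v‖ with hs
  have hvpos : 0 < ‖v‖ := norm_pos_iff.2 hv
  have hae : ∀ᵐ x, U x ≤ U (x - s • v) := by
    filter_upwards [h, P.hasGradientAt_ae] with x hx hg
    have h1 := P.convex.add_inner_gradient_le hg (x - s • v)
    rw [sub_sub_cancel_left, inner_neg_right, inner_smul_right, real_inner_comm, hx] at h1
    linarith
  have hc := P.continuous
  have hall : ∀ x, U x ≤ U (x - s • v) := by
    have hd := Measure.dense_of_ae hae
    have hcl : IsClosed {x | U x ≤ U (x - s • v)} := isClosed_le hc (by fun_prop)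
    intro x
    have := hd.closure_eq ▸ Set.mem_univ x
    rwa [hcl.closure_eq] at this
  have h2 := hall (s • v)
  have h3 := hco (s • v)
  rw [sub_self, P.zero] at h2
  rw [norm_smul, Real.norm_of_nonneg (by positivity), hs, div_mul_cancel₀ _ hvpos.ne',
    mul_div_cancel_right₀ _ hR.ne'] at h3
  linarith

lemma diamondMass_pos (hn : 1 ≤ n) : 0 < diamondMass (fun x => Real.exp (-(U x))) := by
  have hnn : 0 ≤ᵐ[volume] fun x => Real.exp (-(U x)) * (⟪x, gradient U x⟫ - U x) := by
    filter_upwards [P.hasGradientAt_ae] with x hx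
    exact mul_nonneg (Real.exp_pos _).le (P.inner_gradient_sub_nonneg hx)
  rw [P.diamondMass_eq]
  refine lt_of_le_of_ne (integral_nonneg_of_ae hnn) fun h0 => ?_
  rw [eq_comm, integral_eq_zero_iff_of_nonneg_ae hnn P.integrable_inner_gradient_sub] at h0
  set v : E n := EuclideanSpace.single ⟨0, hn⟩ 1 with hv
  have hv0 : v ≠ 0 := by simp [hv]
  refine P.not_ae_inner_gradient_eq_zero hv0 ?_
  obtain ⟨C, hC, hlow⟩ := P.lower
  filter_upwards [h0, P.hasGradientAt_ae] with x hx hg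
  have h1 : ⟪x, gradient U x⟫ - U x = 0 := by
    simpa [(Real.exp_pos _).ne'] using hx
  have h2 := hlow (gradient U x)
  rw [P.conj_gradient hg, h1, ENNReal.ofReal_zero, mul_zero, nonpos_iff_eq_zero,
    ENNReal.ofReal_eq_zero] at h2
  have h3 : gradient U x = 0 := by
    have : ‖gradient U x‖ ^ 2 = 0 := le_antisymm h2 (sq_nonneg _)
    simpa using this
  rw [h3, inner_zero_right]

end ConvexPair

/-! ### Gaussian moments of a measure -/

/-- The continuous linear map of a matrix. -/
abbrev actL (A : Matrix (Fin n) (Fin n) ℝ) : E n →L[ℝ] E n := Matrix.toEuclideanCLM (𝕜 := ℝ) A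

lemma actL_apply (A : Matrix (Fin n) (Fin n) ℝ) (x : E n) : actL A x = act A x := rfl

lemma det_actL (A : Matrix (Fin n) (Fin n) ℝ) : (actL A).det = A.det :=
  LinearMap.det_toLpLin 2 A

/-- The functional `T ↦ ∫ (‖T x‖² / 2)^p dμ`. -/
def gaussMoment (p : ℝ) (μ : Measure (E n)) (T : E n →L[ℝ] E n) : ℝ := ∫ x, (‖T x‖ ^ 2 / 2) ^ p ∂μ

lemma gaussMoment_smul (p : ℝ) (μ : Measure (E n)) (s : ℝ) (T : E n →L[ℝ] E n) :
    gaussMoment p μ (s • T) = (s ^ 2) ^ p * gaussMoment p μ T := by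
  rw [gaussMoment, gaussMoment, ← integral_const_mul]
  congr 1
  funext x
  rw [← Real.mul_rpow (by positivity) (by positivity), _root_.smul_apply, norm_smul, mul_pow,
    Real.norm_eq_abs, sq_abs, mul_div_assoc]

section Moment

variable {p : ℝ} (hp : 1 ≤ p) {μ : Measure (E n)} (hmom : Integrable (fun x => (‖x‖ ^ 2) ^ p) μ)

include hp

lemma norm_rpow_le {c : ℝ} {T : E n →L[ℝ] E n} (hT : ‖T‖ ≤ c) (x : E n) :
    (‖T x‖ ^ 2 / 2) ^ p ≤ (c ^ 2 / 2) ^ p * (‖x‖ ^ 2) ^ p := by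
  have h0 : 0 ≤ c := (norm_nonneg _).trans hT
  rw [← Real.mul_rpow (by positivity) (by positivity)]
  refine Real.rpow_le_rpow (by positivity) ?_ (by positivity)
  have h1 : ‖T x‖ ≤ c * ‖x‖ := (T.le_opNorm x).trans (by gcongr)
  calc ‖T x‖ ^ 2 / 2 ≤ (c * ‖x‖) ^ 2 / 2 := by gcongr
    _ = _ := by ring

lemma continuous_norm_rpow (T : E n →L[ℝ] E n) : Continuous fun x => (‖T x‖ ^ 2 / 2) ^ p :=
  Continuous.rpow_const (by fun_prop) fun x => Or.inr (by positivity)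

include hmom

lemma integrable_norm_rpow (T : E n →L[ℝ] E n) : Integrable (fun x => (‖T x‖ ^ 2 / 2) ^ p) μ := by
  refine (hmom.const_mul ((‖T‖ ^ 2 / 2) ^ p)).mono'
    (continuous_norm_rpow hp T).aestronglyMeasurable (Eventually.of_forall fun x => ?_)
  rw [Real.norm_of_nonneg (by positivity)]
  exact norm_rpow_le hp le_rfl x

lemma continuous_gaussMoment : Continuous (gaussMoment p μ) := by
  rw [continuous_iff_continuousAt]
  intro T₀
  refine continuousAt_of_dominated (bound := fun x => ((‖T₀‖ + 1) ^ 2 / 2) ^ p * (‖x‖ ^ 2) ^ p)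
    (Eventually.of_forall fun T => (continuous_norm_rpow hp T).aestronglyMeasurable) ?_
    (hmom.const_mul _) (Eventually.of_forall fun x => ?_)
  · have : ∀ᶠ T in 𝓝 T₀, ‖T‖ < ‖T₀‖ + 1 :=
      continuous_norm.continuousAt.eventually_lt_const (by linarith)
    filter_upwards [this] with T hT
    refine Eventually.of_forall fun x => ?_
    rw [Real.norm_of_nonneg (by positivity)]
    exact norm_rpow_le hp hT.le x
  · exact (Continuous.rpow_const (by fun_prop) fun T => Or.inr (by positivity)).continuousAt

omit hp hmom in
lemma gaussMoment_nonneg (T : E n →L[ℝ] E n) : 0 ≤ gaussMoment p μ T :=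
  integral_nonneg fun x => by positivity

/-- A vanishing moment means `T x = 0` almost everywhere, which puts `μ` on the hyperplane
orthogonal to a nonzero vector `T* w`. -/
lemma gaussMoment_pos (hnd : ∀ v : E n, v ≠ 0 → ¬ ∀ᵐ x ∂μ, ⟪v, x⟫ = 0) {T : E n →L[ℝ] E n}
    (hT : T ≠ 0) : 0 < gaussMoment p μ T := by
  refine lt_of_le_of_ne (gaussMoment_nonneg T) fun h0 => ?_
  rw [eq_comm, gaussMoment, integral_eq_zero_iff_of_nonneg (fun x => by positivity)
    (integrable_norm_rpow hp hmom T)] at h0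
  have hT' : T.adjoint ≠ 0 := by simpa using hT
  obtain ⟨w, hw⟩ : ∃ w, T.adjoint w ≠ 0 := by
    by_contra! h
    exact hT' (ContinuousLinearMap.ext h)
  refine hnd _ hw ?_
  filter_upwards [h0] with x hx
  have hx' : (‖T x‖ ^ 2 / 2) ^ p = 0 := hx
  rw [Real.rpow_eq_zero (by positivity) (by positivity)] at hx'
  have : T x = 0 := by simpa using hx'
  rw [ContinuousLinearMap.adjoint_inner_left, this, inner_zero_right]

/-- By homogeneity, the positive minimum of the moment on the unit sphere bounds the feasible set,
which is therefore compact. The maximum is nonzero because small multiples of the identity are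
feasible. -/
lemma exists_gaussMoment_le_isMaxOn_det (hn : 1 ≤ n)
    (hnd : ∀ v : E n, v ≠ 0 → ¬ ∀ᵐ x ∂μ, ⟪v, x⟫ = 0) {D : ℝ} (hD : 0 < D) :
    ∃ T : E n →L[ℝ] E n, gaussMoment p μ T ≤ D ∧ T.det ≠ 0 ∧
      ∀ S : E n →L[ℝ] E n, gaussMoment p μ S ≤ D → |S.det| ≤ |T.det| := by
  have hcont := continuous_gaussMoment hp hmom
  have : Nontrivial (E n) := by
    have : Nonempty (Fin n) := ⟨⟨0, hn⟩⟩
    infer_instance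
  have hp0 : 0 < p := by positivity
  obtain ⟨T₁, hT₁, hmin⟩ := (isCompact_sphere (0 : E n →L[ℝ] E n) 1).exists_isMinOn
    ⟨1, by simp⟩ hcont.continuousOn
  set m := gaussMoment p μ T₁ with hm
  have hmpos : 0 < m := gaussMoment_pos hp hmom hnd (by rintro rfl; simp at hT₁)
  have hbound : ∀ T, gaussMoment p μ T ≤ D → ‖T‖ ^ 2 ≤ (D / m) ^ (1 / p) := by
    intro T hT
    rcases eq_or_ne T 0 with rfl | hT0
    · simp only [norm_zero, ne_eq, OfNat.ofNat_ne_zero, not_false_eq_true, zero_pow]; positivity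
    have hpos : 0 < ‖T‖ := norm_pos_iff.2 hT0
    have h1 : m ≤ gaussMoment p μ (‖T‖⁻¹ • T) := by
      apply hmin
      simp [norm_smul, hpos.ne']
    have h2 : gaussMoment p μ T = (‖T‖ ^ 2) ^ p * gaussMoment p μ (‖T‖⁻¹ • T) := by
      rw [← gaussMoment_smul, smul_smul, mul_inv_cancel₀ hpos.ne', one_smul]
    have h3 : (‖T‖ ^ 2) ^ p ≤ D / m := by
      rw [le_div_iff₀ hmpos]
      calc _ ≤ (‖T‖ ^ 2) ^ p * gaussMoment p μ (‖T‖⁻¹ • T) := by gcongr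
        _ ≤ D := h2 ▸ hT
    calc ‖T‖ ^ 2 = ((‖T‖ ^ 2) ^ p) ^ (1 / p) := by
          rw [← Real.rpow_mul (by positivity), mul_one_div_cancel hp0.ne', Real.rpow_one]
      _ ≤ _ := Real.rpow_le_rpow (by positivity) h3 (by positivity)
  have hcomp : IsCompact {T : E n →L[ℝ] E n | gaussMoment p μ T ≤ D} := by
    refine (isCompact_closedBall (0 : E n →L[ℝ] E n) (Real.sqrt ((D / m) ^ (1 / p)))).of_isClosed_subset
      (isClosed_le hcont continuous_const) fun T hT => ?_
    simp only [Metric.mem_closedBall, dist_zero_right]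
    exact Real.le_sqrt_of_sq_le (hbound T hT)
  have hzero : gaussMoment p μ (0 : E n →L[ℝ] E n) = 0 := by
    simp [gaussMoment, Real.zero_rpow hp0.ne']
  obtain ⟨T, hT, hmax⟩ := hcomp.exists_isMaxOn ⟨0, by simpa [hzero] using hD.le⟩
    (f := fun T => |T.det|) (ContinuousLinearMap.continuous_det.abs.continuousOn)
  refine ⟨T, hT, fun h0 => ?_, fun S hS => hmax hS⟩
  have hlim : Tendsto (fun s : ℝ => gaussMoment p μ (s • (1 : E n →L[ℝ] E n))) (𝓝[>] 0) (𝓝 0) := by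
    have h1 : Continuous (fun s : ℝ => gaussMoment p μ (s • (1 : E n →L[ℝ] E n))) :=
      hcont.comp (by fun_prop)
    have := (h1.tendsto 0).mono_left (nhdsWithin_le_nhds (s := Set.Ioi 0))
    rwa [show (0 : ℝ) • (1 : E n →L[ℝ] E n) = 0 by ext; simp, hzero] at this
  obtain ⟨s, hs, hs0⟩ := ((hlim.eventually_lt_const hD).and
    (eventually_mem_nhdsWithin (s := Set.Ioi (0 : ℝ)))).exists
  have hs0 : 0 < s := hs0
  have h2 : |(s • (1 : E n →L[ℝ] E n)).det| ≤ |T.det| := hmax hs.le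
  have h3 : (s • (1 : E n →L[ℝ] E n)).det = s ^ n := by
    rw [ContinuousLinearMap.det, ContinuousLinearMap.toLinearMap_smul, LinearMap.det_smul]
    have : LinearMap.det ((1 : E n →L[ℝ] E n) : E n →ₗ[ℝ] E n) = 1 := LinearMap.det_id
    rw [this, finrank_euclideanSpace, Fintype.card_fin, mul_one]
  rw [h0, h3, abs_zero, abs_of_pos (by positivity)] at h2
  exact absurd h2 (not_le.2 (by positivity))

omit hmom in
lemma rpow_sub_one_mul_self {a : ℝ} (ha : 0 ≤ a) : a ^ (p - 1) * a = a ^ p := by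
  have := Real.rpow_add_one' ha (y := p - 1) (by linarith)
  rw [sub_add_cancel] at this
  exact this.symm

lemma integrable_rpow_sub_one_mul (T : E n →L[ℝ] E n) {b : E n → ℝ} (hb : Continuous b) {c : ℝ}
    (hbc : ∀ x, |b x| ≤ c * ‖x‖ ^ 2) :
    Integrable (fun x => b x * (‖T x‖ ^ 2 / 2) ^ (p - 1)) μ := by
  refine (hmom.const_mul (c * (‖T‖ ^ 2 / 2) ^ (p - 1))).mono'
    (hb.mul (Continuous.rpow_const (by fun_prop) fun x =>
      Or.inr (by linarith))).aestronglyMeasurable (Eventually.of_forall fun x => ?_)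
  rw [norm_mul, Real.norm_of_nonneg (by positivity : 0 ≤ (‖T x‖ ^ 2 / 2) ^ (p - 1)), Real.norm_eq_abs]
  have h1 : (‖T x‖ ^ 2 / 2) ^ (p - 1) ≤ (‖T‖ ^ 2 / 2) ^ (p - 1) * (‖x‖ ^ 2) ^ (p - 1) := by
    rw [← Real.mul_rpow (by positivity) (by positivity)]
    refine Real.rpow_le_rpow (by positivity) ?_ (by linarith)
    calc ‖T x‖ ^ 2 / 2 ≤ (‖T‖ * ‖x‖) ^ 2 / 2 := by gcongr; exact T.le_opNorm x
      _ = _ := by ring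
  calc _ ≤ (c * ‖x‖ ^ 2) * ((‖T‖ ^ 2 / 2) ^ (p - 1) * (‖x‖ ^ 2) ^ (p - 1)) := by
        gcongr
        · exact (abs_nonneg _).trans (hbc x)
        · exact hbc x
    _ = c * (‖T‖ ^ 2 / 2) ^ (p - 1) * ((‖x‖ ^ 2) ^ (p - 1) * ‖x‖ ^ 2) := by ring
    _ = _ := by rw [rpow_sub_one_mul_self hp (by positivity)]

/-- The shape `s + s² d` is what a rank-one perturbation of `T` produces in `‖T x‖² / 2`; see
`sq_norm_act_add_vecMulVec`. -/
lemma hasDerivAt_integral_rpow (T : E n →L[ℝ] E n) {b : E n → ℝ} (hb : Continuous b) {c d : ℝ}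
    (hc : 0 ≤ c) (hd : 0 ≤ d) (hbc : ∀ x, |b x| ≤ c * ‖x‖ ^ 2) :
    HasDerivAt (fun s : ℝ => ∫ x, (‖T x‖ ^ 2 / 2 + (s + s ^ 2 * d) * b x) ^ p ∂μ)
      (p * ∫ x, b x * (‖T x‖ ^ 2 / 2) ^ (p - 1) ∂μ) 0 := by
  set L : ℝ := ‖T‖ ^ 2 / 2 + (1 + d) * c with hL
  have hL0 : 0 ≤ L := by positivity
  have hq : ∀ s ∈ Metric.ball (0 : ℝ) 1, ∀ x : E n,
      |‖T x‖ ^ 2 / 2 + (s + s ^ 2 * d) * b x| ≤ L * ‖x‖ ^ 2 := by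
    intro s hs x
    have hs1 : |s| ≤ 1 := by simpa using (Metric.mem_ball.1 hs).le
    have h1 : |s + s ^ 2 * d| ≤ 1 + d := by
      refine (abs_add_le _ _).trans ?_
      rw [abs_mul, abs_of_nonneg hd, abs_pow]
      gcongr
      exact mul_le_of_le_one_left hd (pow_le_one₀ (abs_nonneg s) hs1)
    have h2 : ‖T x‖ ^ 2 / 2 ≤ ‖T‖ ^ 2 / 2 * ‖x‖ ^ 2 := by
      calc ‖T x‖ ^ 2 / 2 ≤ (‖T‖ * ‖x‖) ^ 2 / 2 := by gcongr; exact T.le_opNorm x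
        _ = _ := by ring
    calc _ ≤ |‖T x‖ ^ 2 / 2| + |(s + s ^ 2 * d) * b x| := abs_add_le _ _
      _ = ‖T x‖ ^ 2 / 2 + |s + s ^ 2 * d| * |b x| := by
        rw [abs_mul, abs_of_nonneg (by positivity : 0 ≤ ‖T x‖ ^ 2 / 2)]
      _ ≤ ‖T‖ ^ 2 / 2 * ‖x‖ ^ 2 + (1 + d) * (c * ‖x‖ ^ 2) := by
        gcongr
        exact hbc x
      _ = _ := by ring
  have hcont : ∀ s : ℝ, ∀ r : ℝ, 0 ≤ r →
      Continuous fun x => (‖T x‖ ^ 2 / 2 + (s + s ^ 2 * d) * b x) ^ r := fun s r hr =>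
    Continuous.rpow_const (by fun_prop) fun x => Or.inr hr
  have key := hasDerivAt_integral_of_dominated_loc_of_deriv_le (μ := μ) (x₀ := (0 : ℝ))
    (F := fun s x => (‖T x‖ ^ 2 / 2 + (s + s ^ 2 * d) * b x) ^ p)
    (F' := fun s x => (1 + 2 * s * d) * b x * p *
      (‖T x‖ ^ 2 / 2 + (s + s ^ 2 * d) * b x) ^ (p - 1))
    (bound := fun x => (1 + 2 * d) * c * p * L ^ (p - 1) * (‖x‖ ^ 2) ^ p)
    (Metric.ball_mem_nhds 0 one_pos)
    (Eventually.of_forall fun s => (hcont s p (by linarith)).aestronglyMeasurable) ?_ ?_ ?_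
    (hmom.const_mul _) ?_
  · have h := key.2
    have hval : ∫ x, (1 + 2 * 0 * d) * b x * p *
        (‖T x‖ ^ 2 / 2 + (0 + 0 ^ 2 * d) * b x) ^ (p - 1) ∂μ =
        p * ∫ x, b x * (‖T x‖ ^ 2 / 2) ^ (p - 1) ∂μ := by
      rw [← integral_const_mul]
      congr 1
      funext x
      simp only [mul_zero, zero_mul, add_zero, one_mul, ne_eq, OfNat.ofNat_ne_zero,
        not_false_eq_true, zero_pow]
      ring
    rwa [hval] at h
  · simpa using integrable_norm_rpow hp hmom T
  · exact Continuous.aestronglyMeasurable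
      ((by fun_prop : Continuous fun x => (1 + 2 * 0 * d) * b x * p).mul
        (hcont 0 (p - 1) (by linarith)))
  · refine Eventually.of_forall fun x s hs => ?_
    have hs1 : |s| ≤ 1 := by simpa using (Metric.mem_ball.1 hs).le
    have h1 : |1 + 2 * s * d| ≤ 1 + 2 * d := by
      refine (abs_add_le _ _).trans ?_
      rw [abs_one, abs_mul, abs_mul, abs_of_nonneg hd, abs_two]
      gcongr
      linarith
    have h2 : |(‖T x‖ ^ 2 / 2 + (s + s ^ 2 * d) * b x) ^ (p - 1)| ≤
        L ^ (p - 1) * (‖x‖ ^ 2) ^ (p - 1) := by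
      rw [← Real.mul_rpow hL0 (by positivity)]
      exact (Real.abs_rpow_le_abs_rpow _ _).trans
        (Real.rpow_le_rpow (abs_nonneg _) (hq s hs x) (by linarith))
    rw [Real.norm_eq_abs, abs_mul, abs_mul, abs_mul, abs_of_nonneg (by linarith : 0 ≤ p)]
    calc _ ≤ (1 + 2 * d) * (c * ‖x‖ ^ 2) * p * (L ^ (p - 1) * (‖x‖ ^ 2) ^ (p - 1)) := by
          gcongr
          exact hbc x
      _ = (1 + 2 * d) * c * p * L ^ (p - 1) * ((‖x‖ ^ 2) ^ (p - 1) * ‖x‖ ^ 2) := by ring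
      _ = _ := by rw [rpow_sub_one_mul_self hp (by positivity)]
  · refine Eventually.of_forall fun x s _ => ?_
    have h1 : HasDerivAt (fun s : ℝ => ‖T x‖ ^ 2 / 2 + (s + s ^ 2 * d) * b x)
        ((1 + 2 * s * d) * b x) s := by
      have := (((hasDerivAt_id s).add ((hasDerivAt_pow 2 s).mul_const d)).mul_const (b x)).const_add
        (‖T x‖ ^ 2 / 2)
      simpa using this
    exact h1.rpow_const (Or.inr hp)

omit hmom in
lemma add_mul_sub_le_rpow {a b : ℝ} (ha : 0 ≤ a) (hb : 0 ≤ b) :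
    a ^ p + p * (a ^ (p - 1) * (b - a)) ≤ b ^ p := by
  rcases ha.eq_or_lt with rfl | ha
  · rcases hp.eq_or_lt with rfl | hp1
    · simp
    · rw [Real.zero_rpow (by linarith), Real.zero_rpow (by linarith)]
      simp only [zero_mul, mul_zero, add_zero]
      positivity
  · have h := one_add_mul_self_le_rpow_one_add (s := b / a - 1)
      (by linarith [div_nonneg hb ha.le]) hp
    rw [add_sub_cancel, Real.div_rpow hb ha.le, le_div_iff₀ (by positivity)] at h
    refine le_trans (le_of_eq ?_) h
    rw [Real.rpow_sub_one ha.ne']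
    field_simp

lemma gaussMoment_add_le (T S : E n →L[ℝ] E n) :
    gaussMoment p μ T + p * ((∫ x, ‖S x‖ ^ 2 / 2 * (‖T x‖ ^ 2 / 2) ^ (p - 1) ∂μ) - gaussMoment p μ T) ≤
      gaussMoment p μ S := by
  have hS : Integrable (fun x => ‖S x‖ ^ 2 / 2 * (‖T x‖ ^ 2 / 2) ^ (p - 1)) μ := by
    refine integrable_rpow_sub_one_mul hp hmom T (by fun_prop) (c := ‖S‖ ^ 2 / 2) fun x => ?_
    rw [abs_of_nonneg (by positivity)]
    calc ‖S x‖ ^ 2 / 2 ≤ (‖S‖ * ‖x‖) ^ 2 / 2 := by gcongr; exact S.le_opNorm x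
      _ = _ := by ring
  have hT := integrable_norm_rpow hp hmom T
  have hd : Integrable (fun x => p * (‖S x‖ ^ 2 / 2 * (‖T x‖ ^ 2 / 2) ^ (p - 1) -
    (‖T x‖ ^ 2 / 2) ^ p)) μ := (hS.sub hT).const_mul p
  rw [gaussMoment, gaussMoment, ← integral_sub hS hT, ← integral_const_mul, ← integral_add hT hd]
  refine integral_mono (hT.add hd) (integrable_norm_rpow hp hmom S) fun x => ?_
  have h := add_mul_sub_le_rpow hp (a := ‖T x‖ ^ 2 / 2) (b := ‖S x‖ ^ 2 / 2) (by positivity)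
    (by positivity)
  have h2 := rpow_sub_one_mul_self hp (a := ‖T x‖ ^ 2 / 2) (by positivity)
  refine le_trans (le_of_eq ?_) h
  linear_combination p * h2

end Moment

/-! ### Determinants and optimal matrices -/

/-- The arithmetic-geometric mean inequality for the eigenvalues, obtained by multiplying `λ ≤
e^{λ-1}`, which is strict unless `λ = 1`. -/
lemma _root_.Matrix.PosSemidef.det_le_one_of_trace_le {M : Matrix (Fin n) (Fin n) ℝ}
    (hM : M.PosSemidef) (htr : M.trace ≤ n) : M.det ≤ 1 ∧ (M.det = 1 → M = 1) := by
  have hH := hM.isHermitian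
  have hdet : M.det = ∏ i, hH.eigenvalues i := by simpa using hH.det_eq_prod_eigenvalues
  have htr' : M.trace = ∑ i, hH.eigenvalues i := by simpa using hH.trace_eq_sum_eigenvalues
  have hnn := hM.eigenvalues_nonneg
  have hle : ∀ i, hH.eigenvalues i ≤ Real.exp (hH.eigenvalues i - 1) := fun i => by
    linarith [Real.add_one_le_exp (hH.eigenvalues i - 1)]
  have hsum : ∑ i, (hH.eigenvalues i - 1) ≤ 0 := by
    rw [Finset.sum_sub_distrib, ← htr']
    simpa using htr
  have hexp : ∏ i, Real.exp (hH.eigenvalues i - 1) ≤ 1 := by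
    rw [← Real.exp_sum]
    exact Real.exp_le_one_iff.2 hsum
  have h1 : M.det ≤ 1 := by
    rw [hdet]
    exact (Finset.prod_le_prod (fun i _ => hnn i) fun i _ => hle i).trans hexp
  refine ⟨h1, fun heq => ?_⟩
  have hpos : ∀ i, 0 < hH.eigenvalues i := by
    intro i
    refine lt_of_le_of_ne (hnn i) fun h0 => ?_
    rw [hdet, Finset.prod_eq_zero (Finset.mem_univ i) h0.symm] at heq
    exact zero_ne_one heq
  have hone : ∀ i, hH.eigenvalues i = 1 := by
    by_contra! hcon
    obtain ⟨i, hi⟩ := hcon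
    have hlt : ∏ i, hH.eigenvalues i < ∏ i, Real.exp (hH.eigenvalues i - 1) := by
      refine Finset.prod_lt_prod (fun i _ => hpos i) (fun i _ => hle i) ⟨i, Finset.mem_univ i, ?_⟩
      have := Real.add_one_lt_exp (sub_ne_zero.2 hi)
      linarith
    linarith
  have hsp := hH.spectral_theorem
  have hd : (Matrix.diagonal (RCLike.ofReal ∘ hH.eigenvalues) : Matrix (Fin n) (Fin n) ℝ) = 1 := by
    rw [← Matrix.diagonal_one]
    congr 1
    funext i
    simp [hone i]
  rw [hd, map_one] at hsp
  exact hsp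

/-- The continuous linear map `φ^{-t}`. -/
abbrev invTransposeL (φ : GL (Fin n) ℝ) : E n →L[ℝ] E n := actL (φ⁻¹).val.transpose

/-- `φ` minimizes `|det φ|` among those with `∫ (‖φ^{-t} x‖² / 2)^p dμ ≤ D`. -/
def IsOptimal (p : ℝ) (μ : Measure (E n)) (D : ℝ) (φ : GL (Fin n) ℝ) : Prop :=
  gaussMoment p μ (invTransposeL φ) ≤ D ∧
    ∀ ψ : GL (Fin n) ℝ, gaussMoment p μ (invTransposeL ψ) ≤ D → |φ.val.det| ≤ |ψ.val.det|

lemma det_inv_transpose_mul (φ : GL (Fin n) ℝ) : (φ⁻¹).val.transpose.det * φ.val.det = 1 := by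
  rw [Matrix.det_transpose, ← Matrix.det_mul, ← Matrix.GeneralLinearGroup.coe_mul]
  simp

lemma exists_inv_transpose_eq {A : Matrix (Fin n) (Fin n) ℝ} (hA : A.det ≠ 0) :
    ∃ φ : GL (Fin n) ℝ, (φ⁻¹).val.transpose = A := by
  refine ⟨(Matrix.GeneralLinearGroup.mkOfDetNeZero A.transpose (by simpa using hA))⁻¹, ?_⟩
  rw [inv_inv]
  change A.transpose.transpose = A
  rw [Matrix.transpose_transpose]

lemma IsOptimal.abs_det_mul_le {p : ℝ} {μ : Measure (E n)} {D : ℝ} {φ : GL (Fin n) ℝ}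
    (h : IsOptimal p μ D φ) {A : Matrix (Fin n) (Fin n) ℝ} (hA : gaussMoment p μ (actL A) ≤ D) :
    |A.det| * |φ.val.det| ≤ 1 := by
  by_cases h0 : A.det = 0
  · simp [h0]
  obtain ⟨ψ, rfl⟩ := exists_inv_transpose_eq h0
  calc _ ≤ |(ψ⁻¹).val.transpose.det| * |ψ.val.det| :=
          mul_le_mul_of_nonneg_left (h.2 ψ hA) (abs_nonneg _)
    _ = 1 := by rw [← abs_mul, det_inv_transpose_mul, abs_one]

/-- Rescaling `A` by `(D/m)^{1/(2p)}`, `m` its moment, makes its moment exactly `D`. The result is a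
scale-invariant inequality free of the constraint, suited to differentiation. -/
lemma IsOptimal.abs_det_mul_rpow_le {p : ℝ} (hp : 1 ≤ p) {μ : Measure (E n)} {D : ℝ} (hD : 0 < D)
    {φ : GL (Fin n) ℝ} (h : IsOptimal p μ D φ) {A : Matrix (Fin n) (Fin n) ℝ}
    (hA : 0 < gaussMoment p μ (actL A)) :
    |A.det| * |φ.val.det| * (D / gaussMoment p μ (actL A)) ^ (n / (2 * p)) ≤ 1 := by
  set m := gaussMoment p μ (actL A) with hm
  set s := (D / m) ^ (1 / (2 * p)) with hs
  have hp0 : 0 < p := by positivity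
  have hs0 : 0 < s := by positivity
  have hmom : gaussMoment p μ (actL (s • A)) = D := by
    have h1 : actL (s • A) = s • actL A := map_smul _ s A
    rw [h1, gaussMoment_smul, ← hm, hs, ← Real.rpow_natCast, ← Real.rpow_mul (by positivity),
      ← Real.rpow_mul (by positivity)]
    have : 1 / (2 * p) * (((2 : ℕ) : ℝ) * p) = 1 := by push_cast; field_simp
    rw [this, Real.rpow_one]
    field_simp
  have h2 := h.abs_det_mul_le hmom.le
  rw [Matrix.det_smul, Fintype.card_fin, abs_mul, abs_of_pos (by positivity)] at h2
  have h3 : (D / m) ^ ((n : ℝ) / (2 * p)) = s ^ n := by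
    rw [hs, ← Real.rpow_natCast, ← Real.rpow_mul (by positivity)]
    congr 1
    field_simp
  rw [h3]
  linarith

lemma sq_norm_act_add_vecMulVec (φ : GL (Fin n) ℝ) (y x : E n) (s : ℝ) :
    ‖actL ((φ⁻¹).val.transpose + s • Matrix.vecMulVec (act φ.val y).ofLp y.ofLp) x‖ ^ 2 / 2 =
      ‖invTransposeL φ x‖ ^ 2 / 2 + (s + s ^ 2 * (‖act φ.val y‖ ^ 2 / 2)) * ⟪x, y⟫ ^ 2 := by
  have h1 : actL ((φ⁻¹).val.transpose + s • Matrix.vecMulVec (act φ.val y).ofLp y.ofLp) x =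
      invTransposeL φ x + (s * ⟪x, y⟫) • act φ.val y := by
    rw [actL, map_add, map_smul]
    simp only [_root_.add_apply, _root_.smul_apply, mul_smul]
    congr 2
    ext i
    rw [Matrix.ofLp_toEuclideanCLM, Matrix.vecMulVec_mulVec]
    simp [EuclideanSpace.inner_eq_star_dotProduct, mul_comm]
  have h2 : ⟪invTransposeL φ x, act φ.val y⟫ = ⟪x, y⟫ := by
    rw [actL_apply, inner_act_left, act_act, ← Matrix.GeneralLinearGroup.coe_mul]
    simp
  rw [h1, norm_add_sq_real, inner_smul_right, h2, norm_smul, mul_pow, Real.norm_eq_abs, sq_abs]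
  ring

/-- Matrix determinant lemma, after factoring out `φ^{-t}`. -/
lemma det_add_vecMulVec (φ : GL (Fin n) ℝ) (y : E n) (s : ℝ) :
    ((φ⁻¹).val.transpose + s • Matrix.vecMulVec (act φ.val y).ofLp y.ofLp).det =
      (φ⁻¹).val.transpose.det * (1 + s * ‖act φ.val y‖ ^ 2) := by
  have hmul : φ.val.transpose * (φ⁻¹).val.transpose = 1 := by
    rw [← Matrix.transpose_mul, ← Matrix.GeneralLinearGroup.coe_mul]
    simp
  have hmul' : (φ⁻¹).val.transpose * φ.val.transpose = 1 := mul_eq_one_comm.1 hmul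
  have h1 : (φ⁻¹).val.transpose + s • Matrix.vecMulVec (act φ.val y).ofLp y.ofLp =
      (φ⁻¹).val.transpose * (1 + Matrix.replicateCol Unit (φ.val.transpose.mulVec
        (act φ.val y).ofLp) * Matrix.replicateRow Unit (s • y.ofLp)) := by
    rw [mul_add, mul_one, ← Matrix.mul_assoc, ← Matrix.replicateCol_mulVec, Matrix.mulVec_mulVec,
      hmul', Matrix.one_mulVec, ← Matrix.vecMulVec_eq, Matrix.vecMulVec_smul]
  rw [h1, Matrix.det_mul, Matrix.det_one_add_replicateCol_mul_replicateRow]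
  congr 2
  have h2 : ‖act φ.val y‖ ^ 2 = (act φ.val y).ofLp ⬝ᵥ (act φ.val y).ofLp := by
    rw [← real_inner_self_eq_norm_sq, EuclideanSpace.inner_eq_star_dotProduct, star_trivial]
  rw [h2, smul_dotProduct, Matrix.mulVec_transpose, smul_eq_mul, dotProduct_comm,
    ← Matrix.dotProduct_mulVec]
  rfl

lemma invTransposeL_ne_zero (hn : 1 ≤ n) (φ : GL (Fin n) ℝ) : invTransposeL φ ≠ 0 := by
  intro h
  have h1 : (φ⁻¹).val.transpose = 0 :=
    (Matrix.toEuclideanCLM (n := Fin n) (𝕜 := ℝ)).injective (h.trans (map_zero _).symm)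
  have h2 := det_inv_transpose_mul φ
  have : Nonempty (Fin n) := ⟨⟨0, hn⟩⟩
  rw [h1, Matrix.det_zero, zero_mul] at h2
  exact zero_ne_one h2

/-! ### Existence, first-order condition and uniqueness -/

section Optimum

variable {p : ℝ} (hp : 1 ≤ p) {μ : Measure (E n)} (hmom : Integrable (fun x => (‖x‖ ^ 2) ^ p) μ)
  (hn : 1 ≤ n) (hnd : ∀ v : E n, v ≠ 0 → ¬ ∀ᵐ x ∂μ, ⟪v, x⟫ = 0) {D : ℝ} (hD : 0 < D)

include hp hmom hn hnd hD

lemma exists_isOptimal : ∃ φ : GL (Fin n) ℝ, IsOptimal p μ D φ := by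
  obtain ⟨T, hT, hdet, hmax⟩ := exists_gaussMoment_le_isMaxOn_det hp hmom hn hnd hD
  obtain ⟨A, rfl⟩ : ∃ A, actL A = T := (Matrix.toEuclideanCLM (n := Fin n) (𝕜 := ℝ)).surjective T
  rw [det_actL] at hdet
  obtain ⟨φ, hφ⟩ := exists_inv_transpose_eq hdet
  subst hφ
  refine ⟨φ, hT, fun ψ hψ => ?_⟩
  have h1 := hmax _ hψ
  rw [det_actL, det_actL] at h1
  have h2 : |(φ⁻¹).val.transpose.det| * |φ.val.det| = 1 := by
    rw [← abs_mul, det_inv_transpose_mul, abs_one]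
  have h3 : |(ψ⁻¹).val.transpose.det| * |ψ.val.det| = 1 := by
    rw [← abs_mul, det_inv_transpose_mul, abs_one]
  have h4 : 0 < |(φ⁻¹).val.transpose.det| := abs_pos.2 hdet
  refine le_of_mul_le_mul_left ?_ h4
  rw [h2, ← h3]
  gcongr

lemma IsOptimal.gaussMoment_eq {φ : GL (Fin n) ℝ} (h : IsOptimal p μ D φ) :
    gaussMoment p μ (invTransposeL φ) = D := by
  have hpos := gaussMoment_pos hp hmom hnd (invTransposeL_ne_zero hn φ)
  refine le_antisymm h.1 ?_
  have h1 := h.abs_det_mul_rpow_le hp hD hpos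
  rw [← abs_mul, det_inv_transpose_mul, abs_one, one_mul] at h1
  by_contra! hlt
  have h2 : 1 < D / gaussMoment p μ (invTransposeL φ) := by rwa [one_lt_div hpos]
  have h3 : 0 < (n : ℝ) / (2 * p) := by positivity
  exact absurd h1 (not_le.2 (Real.one_lt_rpow h2 h3))

lemma IsOptimal.mul_sq_norm_eq {φ : GL (Fin n) ℝ} (h : IsOptimal p μ D φ) (y : E n) :
    D * ‖act φ.val y‖ ^ 2 =
      n / 2 * ∫ x, ⟪x, y⟫ ^ 2 * (‖invTransposeL φ x‖ ^ 2 / 2) ^ (p - 1) ∂μ := by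
  have hm := h.gaussMoment_eq hp hmom hn hnd hD
  set w := act φ.val y with hw
  set I := ∫ x, ⟪x, y⟫ ^ 2 * (‖invTransposeL φ x‖ ^ 2 / 2) ^ (p - 1) ∂μ with hI
  set F : ℝ → ℝ := fun s => ∫ x, (‖invTransposeL φ x‖ ^ 2 / 2 +
    (s + s ^ 2 * (‖w‖ ^ 2 / 2)) * ⟪x, y⟫ ^ 2) ^ p ∂μ with hF
  have hF0 : F 0 = D := by
    rw [← hm, hF, gaussMoment]
    simp
  have hFd : HasDerivAt F (p * I) 0 := by
    refine hasDerivAt_integral_rpow hp hmom (invTransposeL φ) (b := fun x => ⟪x, y⟫ ^ 2)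
      (c := ‖y‖ ^ 2) (by fun_prop) (by positivity) (by positivity) fun x => ?_
    rw [abs_of_nonneg (by positivity), ← mul_pow, ← sq_abs]
    gcongr
    rw [mul_comm]
    exact abs_real_inner_le_norm x y
  have hFA : ∀ s, F s = gaussMoment p μ
      (actL ((φ⁻¹).val.transpose + s • Matrix.vecMulVec w.ofLp y.ofLp)) := by
    intro s
    rw [gaussMoment]
    refine integral_congr_ae (Eventually.of_forall fun x => ?_)
    simp only
    rw [sq_norm_act_add_vecMulVec]
  set c : ℝ := n / (2 * p) with hc
  -- Up to sign and a constant, the logarithm of the scale-invariant quantity along the perturbation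
  -- `φ^{-t} + s (φ y) yᵗ`. Optimality makes `s = 0` a local minimum, and `G'(0) = 0` is the claim.
  set G : ℝ → ℝ := fun s => c * Real.log (F s) - Real.log (1 + s * ‖w‖ ^ 2) with hG
  have hGd : HasDerivAt G (c * (p * I / F 0) - ‖w‖ ^ 2 / (1 + 0 * ‖w‖ ^ 2)) 0 := by
    have h1 : HasDerivAt (fun s : ℝ => 1 + s * ‖w‖ ^ 2) (‖w‖ ^ 2) 0 := by
      simpa using ((hasDerivAt_id (0 : ℝ)).mul_const (‖w‖ ^ 2)).const_add 1
    exact ((hFd.log (by rw [hF0]; exact hD.ne')).const_mul c).sub (h1.log (by simp))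
  have hmin : IsLocalMin G 0 := by
    have h1 : ∀ᶠ s in 𝓝 (0 : ℝ), 0 < F s :=
      hFd.continuousAt.eventually_const_lt (by rw [hF0]; exact hD)
    have h2 : ∀ᶠ s in 𝓝 (0 : ℝ), 0 < 1 + s * ‖w‖ ^ 2 :=
      (by fun_prop : Continuous fun s : ℝ => 1 + s * ‖w‖ ^ 2).continuousAt.eventually_const_lt
        (by simp)
    filter_upwards [h1, h2] with s hs1 hs2
    have h3 := h.abs_det_mul_rpow_le hp hD (hFA s ▸ hs1)
    rw [← hFA s, det_add_vecMulVec, ← abs_mul, mul_right_comm, det_inv_transpose_mul, one_mul, ← hw, abs_of_pos hs2, ← hc] at h3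
    have h4 := Real.log_nonpos (by positivity) h3
    rw [Real.log_mul hs2.ne' (by positivity), Real.log_rpow (by positivity),
      Real.log_div hD.ne' hs1.ne'] at h4
    simp only [hG, hF0, zero_mul, add_zero, Real.log_one, sub_zero]
    linarith
  have h0 := hmin.hasDerivAt_eq_zero hGd
  have hp0 : 0 < p := by positivity
  rw [hF0, zero_mul, add_zero, div_one, hc] at h0
  field_simp at h0
  linarith

omit hnd in
-- The condition is used at `y = ψ⁻¹ e_i` and summed, since `∑ ⟨x, ψ⁻¹ e_i⟩² = ‖ψ^{-t} x‖²`. The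
-- tangent inequality `gaussMoment_add_le` bounds the resulting mixed integral by `D`.
lemma sum_sq_norm_act_le {φ ψ : GL (Fin n) ℝ} (hφ : gaussMoment p μ (invTransposeL φ) = D)
    (hcond : ∀ y : E n, D * ‖act φ.val y‖ ^ 2 =
      n / 2 * ∫ x, ⟪x, y⟫ ^ 2 * (‖invTransposeL φ x‖ ^ 2 / 2) ^ (p - 1) ∂μ)
    (hψ : gaussMoment p μ (invTransposeL ψ) ≤ D) :
    ∑ i, ‖act (φ.val * (ψ⁻¹).val) (EuclideanSpace.single i 1)‖ ^ 2 ≤ n := by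
  have h1 := gaussMoment_add_le hp hmom (invTransposeL φ) (invTransposeL ψ)
  have hsum : ∀ x : E n, ‖invTransposeL ψ x‖ ^ 2 =
      ∑ i, ⟪x, act (ψ⁻¹).val (EuclideanSpace.single i 1)⟫ ^ 2 := by
    intro x
    rw [EuclideanSpace.real_norm_sq_eq]
    refine Finset.sum_congr rfl fun i _ => ?_
    rw [← inner_act_left, EuclideanSpace.inner_single_right]
    simp [actL_apply]
  have hint : ∀ y : E n, Integrable
      (fun x => ⟪x, y⟫ ^ 2 * (‖invTransposeL φ x‖ ^ 2 / 2) ^ (p - 1)) μ := by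
    intro y
    refine integrable_rpow_sub_one_mul hp hmom _ (by fun_prop) (c := ‖y‖ ^ 2) fun x => ?_
    rw [abs_of_nonneg (by positivity), ← mul_pow, ← sq_abs]
    gcongr
    rw [mul_comm]
    exact abs_real_inner_le_norm x y
  have h2 : n * ∫ x, ‖invTransposeL ψ x‖ ^ 2 / 2 * (‖invTransposeL φ x‖ ^ 2 / 2) ^ (p - 1) ∂μ =
      D * ∑ i, ‖act (φ.val * (ψ⁻¹).val) (EuclideanSpace.single i 1)‖ ^ 2 := by
    have h3 : (fun x => ‖invTransposeL ψ x‖ ^ 2 / 2 * (‖invTransposeL φ x‖ ^ 2 / 2) ^ (p - 1)) =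
        fun x => 1 / 2 * ∑ i, ⟪x, act (ψ⁻¹).val (EuclideanSpace.single i 1)⟫ ^ 2 *
          (‖invTransposeL φ x‖ ^ 2 / 2) ^ (p - 1) := by
      funext x
      rw [hsum, ← Finset.sum_mul]
      ring
    rw [h3, integral_const_mul, integral_finsetSum _ fun i _ => hint _, Finset.mul_sum,
      Finset.mul_sum, Finset.mul_sum]
    refine Finset.sum_congr rfl fun i _ => ?_
    rw [← act_act, hcond]
    ring
  rw [hφ] at h1
  have hp0 : 0 < p := by positivity
  have h4 : ∫ x, ‖invTransposeL ψ x‖ ^ 2 / 2 * (‖invTransposeL φ x‖ ^ 2 / 2) ^ (p - 1) ∂μ ≤ D := by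
    by_contra! hlt
    nlinarith [mul_pos hp0 (sub_pos.2 hlt)]
  have hn0 : (0 : ℝ) < n := by exact_mod_cast hn
  have h5 := mul_le_mul_of_nonneg_left h4 hn0.le
  rw [h2] at h5
  exact le_of_mul_le_mul_left (by linarith) hD

omit hnd in
theorem isOptimal_of_forall_mul_sq_norm_eq {φ : GL (Fin n) ℝ}
    (hφ : gaussMoment p μ (invTransposeL φ) = D)
    (hcond : ∀ y : E n, D * ‖act φ.val y‖ ^ 2 =
      n / 2 * ∫ x, ⟪x, y⟫ ^ 2 * (‖invTransposeL φ x‖ ^ 2 / 2) ^ (p - 1) ∂μ) :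
    IsOptimal p μ D φ ∧ ∀ ψ, IsOptimal p μ D ψ → ∀ x, ‖act φ.val x‖ = ‖act ψ.val x‖ := by
  have key : ∀ ψ : GL (Fin n) ℝ, gaussMoment p μ (invTransposeL ψ) ≤ D →
      |φ.val.det| ≤ |ψ.val.det| ∧
        (|φ.val.det| = |ψ.val.det| → ∀ x, ‖act φ.val x‖ = ‖act ψ.val x‖) := by
    intro ψ hψ
    set N := φ.val * (ψ⁻¹).val with hN
    have hNψ : N * ψ.val = φ.val := by
      rw [hN, Matrix.mul_assoc, ← Matrix.GeneralLinearGroup.coe_mul]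
      simp
    have htr : (N.transpose * N).trace ≤ n := by
      refine le_trans (le_of_eq ?_) (sum_sq_norm_act_le hp hmom hn hD hφ hcond hψ)
      rw [Matrix.trace]
      refine Finset.sum_congr rfl fun i _ => ?_
      rw [EuclideanSpace.real_norm_sq_eq, Matrix.diag_apply, Matrix.mul_apply]
      refine Finset.sum_congr rfl fun j _ => ?_
      simp [act_apply, sq, hN]
    have hpsd : (N.transpose * N).PosSemidef := by
      simpa using Matrix.posSemidef_conjTranspose_mul_self N
    obtain ⟨h1, h2⟩ := hpsd.det_le_one_of_trace_le htr
    rw [Matrix.det_mul, Matrix.det_transpose] at h1 h2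
    have hdet : |φ.val.det| = |N.det| * |ψ.val.det| := by rw [← hNψ, Matrix.det_mul, abs_mul]
    have hψ0 : 0 < |ψ.val.det| := abs_pos.2 (Matrix.GeneralLinearGroup.det_ne_zero ψ)
    have hN1 : |N.det| ≤ 1 := by
      rw [← abs_one, ← sq_le_sq]; nlinarith
    refine ⟨?_, fun heq x => ?_⟩
    · rw [hdet]
      exact mul_le_of_le_one_left hψ0.le hN1
    · rw [hdet] at heq
      have h3 : |N.det| = 1 := by
        have := mul_right_cancel₀ hψ0.ne' (heq.trans (one_mul _).symm)
        exact this
      have h4 := h2 (by rw [← abs_mul_abs_self, h3, one_mul])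
      have h5 : ∀ z : E n, ‖act N z‖ ^ 2 = ‖z‖ ^ 2 := by
        intro z
        rw [← real_inner_self_eq_norm_sq, ← real_inner_self_eq_norm_sq, ← inner_act_left, act_act,
          h4, act_one]
      rw [← hNψ, ← act_act]
      exact (sq_eq_sq₀ (norm_nonneg _) (norm_nonneg _)).1 (h5 _)
  refine ⟨⟨hφ.le, fun ψ hψ => (key ψ hψ).1⟩, fun ψ hψ => ?_⟩
  exact (key ψ hψ.1).2 (le_antisymm (key ψ hψ.1).1 (hψ.2 φ hφ.le))

end Optimum

/-! ### Gaussian masses and the surface area measure -/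

lemma integral_gaussian (φ : GL (Fin n) ℝ) : J (gaussian φ) = gaussConst n / |φ.val.det| := by
  have hdet : LinearMap.det (Matrix.toEuclideanLin φ.val) = φ.val.det := LinearMap.det_toLpLin 2 _
  have hdet0 : φ.val.det ≠ 0 := Matrix.GeneralLinearGroup.det_ne_zero φ
  have hmap := Measure.map_linearMap_addHaar_eq_smul_addHaar (volume : Measure (E n))
    (f := Matrix.toEuclideanLin φ.val) (by rw [hdet]; exact hdet0)
  have h1 : J (gaussian φ) = ∫ z, Real.exp (-(1 / 2) * ‖z‖ ^ 2)
      ∂(Measure.map (Matrix.toEuclideanLin φ.val) (volume : Measure (E n))) := by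
    rw [integral_map (LinearMap.continuous_of_finiteDimensional _).aemeasurable
      (Continuous.aestronglyMeasurable (by fun_prop))]
    rw [J]
    congr 1
    funext x
    simp only [gaussian, act]
    congr 1
    ring
  rw [h1, hmap, integral_smul_measure, GaussianFourier.integral_rexp_neg_mul_sq_norm (by norm_num),
    hdet, ENNReal.toReal_ofReal (abs_nonneg _), finrank_euclideanSpace, Fintype.card_fin, gaussConst,
    abs_inv, smul_eq_mul, div_eq_inv_mul (_ ^ _) |_|]
  congr 2
  ring

namespace ConvexPair

variable {U : E n → ℝ} {k : E n → ℝ≥0∞} (P : ConvexPair U k) {p : ℝ} (hp : 1 ≤ p)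

/-- The density `h(∇U)^{1-p} e^{-U}`. -/
def surfaceDensity (p : ℝ) (U : E n → ℝ) (x : E n) : ℝ≥0∞ :=
  ENNReal.ofReal (⟪x, gradient U x⟫ - U x) ^ (1 - p) * ENNReal.ofReal (Real.exp (-(U x)))

include P

lemma measurable_surfaceDensity : Measurable (surfaceDensity p U) := by
  have h1 := measurable_gradient U
  have h2 := P.continuous.measurable
  unfold surfaceDensity
  fun_prop

lemma surfaceMeasure_eq {f : E n → ℝ} (hf : f = expNeg fun x => (U x : EReal))
    (hk : ∀ y, supportFn f y = k y) :
    surfaceMeasure p f = (volume.withDensity (surfaceDensity p U)).map (gradient U) := by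
  have hneg : negLog f = fun x => (U x : EReal) := by rw [hf, negLog_expNeg (by simp)]
  have hgrad : gradU f = gradient U := by simp [gradU, hneg]
  have hdom : gradDomain f = {x | DifferentiableAt ℝ U x} := by simp [gradDomain, hneg]
  rw [surfaceMeasure, hgrad, hdom, Measure.restrict_eq_self_of_ae_mem (s := {x | DifferentiableAt ℝ U x})
    P.convex.ae_differentiableAt]
  congr 1
  refine withDensity_congr_ae ?_
  filter_upwards [P.hasGradientAt_ae] with x hx
  rw [hk, EReal.toENNReal_coe, P.conj_gradient hx, surfaceDensity, hf, expNeg_coe]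

lemma lintegral_map_surfaceDensity {g : E n → ℝ≥0∞} (hg : Measurable g) :
    ∫⁻ x, g x ∂((volume.withDensity (surfaceDensity p U)).map (gradient U)) =
      ∫⁻ x, surfaceDensity p U x * g (gradient U x) := by
  rw [lintegral_map hg (measurable_gradient U)]
  exact lintegral_withDensity_eq_lintegral_mul _ P.measurable_surfaceDensity
    (hg.comp (measurable_gradient U))

include hp in
-- Since `1 - p ≤ 0`, the density never vanishes, so null sets pull back to Lebesgue null sets and
-- the statement for `∇U` applies.
lemma not_ae_inner_eq_zero_surface {v : E n} (hv : v ≠ 0) :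
    ¬ ∀ᵐ x ∂((volume.withDensity (surfaceDensity p U)).map (gradient U)), ⟪v, x⟫ = 0 := by
  intro h
  have h1 := ae_of_ae_map (measurable_gradient U).aemeasurable h
  rw [ae_withDensity_iff P.measurable_surfaceDensity] at h1
  refine P.not_ae_inner_gradient_eq_zero hv ?_
  filter_upwards [h1] with x hx
  refine hx (mul_ne_zero (fun h0 => ?_) ?_)
  · rcases ENNReal.rpow_eq_zero_iff.1 h0 with h2 | h2
    · linarith [h2.2]
    · exact ENNReal.ofReal_ne_top h2.1
  · rw [ne_eq, ENNReal.ofReal_eq_zero, not_le]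
    exact Real.exp_pos _

include hp

/-- The bound `‖x‖² ≤ C h` reduces the integrand to `C^p h^{1-p} h^p ≤ C^p h`, valid at `h = 0` too
because `⊤ * 0 = 0`. The remaining integral is `J(f^⋄)` up to a constant. -/
lemma integrable_sq_norm_rpow_surface :
    Integrable (fun x => (‖x‖ ^ 2) ^ p)
      ((volume.withDensity (surfaceDensity p U)).map (gradient U)) := by
  have hp0 : 0 < p := by positivity
  have hcont : Continuous fun x : E n => (‖x‖ ^ 2) ^ p :=
    Continuous.rpow_const (by fun_prop) fun x => Or.inr hp0.le
  refine ⟨hcont.aestronglyMeasurable, ?_⟩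
  rw [hasFiniteIntegral_iff_ofReal (Eventually.of_forall fun x => by positivity),
    P.lintegral_map_surfaceDensity hcont.measurable.ennreal_ofReal]
  obtain ⟨C, hC, hlow⟩ := P.lower
  have hle : ∀ᵐ x, surfaceDensity p U x * ENNReal.ofReal ((‖gradient U x‖ ^ 2) ^ p) ≤
      C ^ p * ENNReal.ofReal (Real.exp (-(U x)) * (⟪x, gradient U x⟫ - U x)) := by
    filter_upwards [P.hasGradientAt_ae] with x hx
    have h1 := hlow (gradient U x)
    rw [P.conj_gradient hx] at h1
    set a := ENNReal.ofReal (⟪x, gradient U x⟫ - U x) with ha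
    have hat : a ≠ ⊤ := ENNReal.ofReal_ne_top
    have h2 : a ^ (1 - p) * a ^ p ≤ a := by
      rcases eq_or_ne a 0 with h0 | h0
      · simp [h0, hp0]
      · rw [← ENNReal.rpow_add _ _ h0 hat, sub_add_cancel, ENNReal.rpow_one]
    calc surfaceDensity p U x * ENNReal.ofReal ((‖gradient U x‖ ^ 2) ^ p)
        ≤ a ^ (1 - p) * ENNReal.ofReal (Real.exp (-(U x))) * (C * a) ^ p := by
          rw [← ENNReal.ofReal_rpow_of_nonneg (by positivity) hp0.le, surfaceDensity, ← ha]
          gcongr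
      _ = C ^ p * (ENNReal.ofReal (Real.exp (-(U x))) * (a ^ (1 - p) * a ^ p)) := by
          rw [ENNReal.mul_rpow_of_nonneg _ _ hp0.le]; ring
      _ ≤ C ^ p * (ENNReal.ofReal (Real.exp (-(U x))) * a) := by gcongr
      _ = _ := by rw [ha, ENNReal.ofReal_mul (Real.exp_pos _).le]
  refine (lintegral_mono_ae hle).trans_lt ?_
  rw [lintegral_const_mul' _ _ (ENNReal.rpow_ne_top_of_nonneg hp0.le hC)]
  exact ENNReal.mul_lt_top (ENNReal.rpow_ne_top_of_nonneg hp0.le hC).lt_top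
    P.integrable_inner_gradient_sub.lintegral_lt_top

lemma exists_rpow_le (T : E n →L[ℝ] E n) : ∃ M : ℝ, 0 ≤ M ∧ ∀ y,
    ENNReal.ofReal (‖T y‖ ^ 2 / 2) ^ p ≤ ENNReal.ofReal M * k y ^ p := by
  have hp0 : 0 < p := by positivity
  obtain ⟨C, hC, hlow⟩ := P.lower
  refine ⟨(‖T‖ ^ 2 / 2 * C.toReal) ^ p, by positivity, fun y => ?_⟩
  rw [← ENNReal.ofReal_rpow_of_nonneg (by positivity) hp0.le,
    ← ENNReal.mul_rpow_of_nonneg _ _ hp0.le]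
  gcongr
  calc ENNReal.ofReal (‖T y‖ ^ 2 / 2) ≤ ENNReal.ofReal (‖T‖ ^ 2 / 2 * ‖y‖ ^ 2) := by
        gcongr
        calc ‖T y‖ ^ 2 / 2 ≤ (‖T‖ * ‖y‖) ^ 2 / 2 := by gcongr; exact T.le_opNorm y
          _ = _ := by ring
    _ = ENNReal.ofReal (‖T‖ ^ 2 / 2) * ENNReal.ofReal (‖y‖ ^ 2) := ENNReal.ofReal_mul (by positivity)
    _ ≤ ENNReal.ofReal (‖T‖ ^ 2 / 2) * (C * k y) := by gcongr; exact hlow y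
    _ = _ := by rw [ENNReal.ofReal_mul (by positivity), ENNReal.ofReal_toReal hC, mul_assoc]

lemma gaussMoment_surface (T : E n →L[ℝ] E n) :
    gaussMoment p ((volume.withDensity (surfaceDensity p U)).map (gradient U)) T =
      ∫ x, Real.exp (-(U x)) * ((‖T (gradient U x)‖ ^ 2 / 2) ^ p *
        (⟪x, gradient U x⟫ - U x) ^ (1 - p)) := by
  have hp0 : 0 < p := by positivity
  have hcont := continuous_norm_rpow hp T
  have hm := measurable_gradient U
  have hU := P.continuous.measurable
  have hTm : Measurable T := T.continuous.measurable
  obtain ⟨M, -, hM⟩ := P.exists_rpow_le hp T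
  have hnn : ∀ᵐ x, 0 ≤ Real.exp (-(U x)) * ((‖T (gradient U x)‖ ^ 2 / 2) ^ p *
      (⟪x, gradient U x⟫ - U x) ^ (1 - p)) := by
    filter_upwards [P.hasGradientAt_ae] with x hx
    have := P.inner_gradient_sub_nonneg hx
    positivity
  rw [gaussMoment, integral_eq_lintegral_of_nonneg_ae (Eventually.of_forall fun x => by positivity)
    hcont.aestronglyMeasurable, P.lintegral_map_surfaceDensity hcont.measurable.ennreal_ofReal,
    integral_eq_lintegral_of_nonneg_ae hnn (Measurable.aestronglyMeasurable (by fun_prop))]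
  congr 1
  refine lintegral_congr_ae ?_
  filter_upwards [P.hasGradientAt_ae] with x hx
  have h0 := P.inner_gradient_sub_nonneg hx
  rw [ENNReal.ofReal_mul (Real.exp_pos _).le, surfaceDensity]
  -- Powers in `[0, +∞]` and real powers disagree on `0^{1-p}` when `p > 1`, but there the other
  -- factor is zero.
  rcases h0.eq_or_lt with h | h
  · have hq := P.eq_zero_of_inner_gradient_sub_eq_zero hp (q := fun y => ‖T y‖ ^ 2 / 2)
      (fun y => by positivity) hM hx h.symm
    rw [hq, Real.zero_rpow hp0.ne']
    simp
  · rw [ENNReal.ofReal_mul (by positivity), ENNReal.ofReal_rpow_of_pos h]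
    ring

theorem hasFirstVariation_gaussian {f : E n → ℝ} (hf : f = expNeg fun x => (U x : EReal))
    (hk : ∀ y, supportFn f y = k y) (φ : GL (Fin n) ℝ) :
    HasFirstVariation p f (gaussian φ) (1 / p * gaussMoment p (surfaceMeasure p f)
      (invTransposeL φ)) := by
  obtain ⟨M, hM0, hM⟩ := P.exists_rpow_le hp (invTransposeL φ)
  have h := P.tendsto_integral_expNeg_conj_pSum hp (q := fun y => ‖invTransposeL φ y‖ ^ 2 / 2)
    (fun y => by positivity) (by fun_prop) hM0 hM
  have hJ : J f = ∫ x, Real.exp (-(U x)) := by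
    rw [J, hf]; simp only [expNeg_coe]
  have hsum : ∀ t : ℝ, asplundSum p 1 f t (gaussian φ) = expNeg (conj fun y =>
      (pSum p k (fun y => ‖invTransposeL φ y‖ ^ 2 / 2) t y : EReal)) := by
    intro t
    simp only [asplundSum, hk, EReal.toENNReal_coe, supportFn_gaussian, EReal.real_coe_toENNReal,
      ENNReal.ofReal_one, one_mul, pSum, actL_apply]
  rw [HasFirstVariation, hJ, P.surfaceMeasure_eq hf hk, P.gaussMoment_surface hp, ← integral_const_mul]
  simp only [hsum]
  simp only [mul_left_comm (Real.exp _) (1 / p)] at h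
  exact h

end ConvexPair

lemma scale_pos (φ : GL (Fin n) ℝ) : 0 < scale φ := by
  have h1 : 0 < |φ.val.det| := abs_pos.2 (Matrix.GeneralLinearGroup.det_ne_zero φ)
  have h2 : 0 < gaussConst n := by unfold gaussConst; positivity
  rw [scale, integral_gaussian]
  positivity

lemma scaledSupport_eq (φ : GL (Fin n) ℝ) (x : E n) :
    scaledSupport φ x = scale φ * (‖invTransposeL φ x‖ ^ 2 / 2) := by
  rw [scaledSupport, supportFn_gaussian_one, EReal.toReal_coe, norm_smul, mul_pow,
    Real.norm_of_nonneg (Real.sqrt_nonneg _), Real.sq_sqrt (scale_pos φ).le, mul_div_assoc,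
    actL_apply]

lemma scaledPolarSupport_eq (φ : GL (Fin n) ℝ) (y : E n) :
    scaledPolarSupport φ y = (scale φ)⁻¹ * (‖act φ.val y‖ ^ 2 / 2) := by
  rw [scaledPolarSupport, supportFn_gaussian_one, EReal.toReal_coe, norm_smul, mul_pow,
    Real.norm_of_nonneg (inv_nonneg.2 (Real.sqrt_nonneg _)), inv_pow, Real.sq_sqrt (scale_pos φ).le,
    mul_div_assoc]

lemma J_gaussian_div_le_iff (φ ψ : GL (Fin n) ℝ) :
    J (gaussian ψ) / gaussConst n ≤ J (gaussian φ) / gaussConst n ↔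
      |φ.val.det| ≤ |ψ.val.det| := by
  have h1 : 0 < |φ.val.det| := abs_pos.2 (Matrix.GeneralLinearGroup.det_ne_zero φ)
  have h2 : 0 < |ψ.val.det| := abs_pos.2 (Matrix.GeneralLinearGroup.det_ne_zero ψ)
  have h3 : 0 < gaussConst n := by unfold gaussConst; positivity
  rw [div_le_div_iff_of_pos_right h3, integral_gaussian, integral_gaussian,
    div_le_div_iff_of_pos_left h3 h2 h1]

end LpJohn

end

/-! ### The theorem -/

theorem theorem3p9 (n : ℕ) (hn : 1 ≤ n) (p : ℝ) (hp : 1 ≤ p)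
    (f : LpJohn.E n → ℝ) (hf : f ∈ LpJohn.classA0 n)
    (hfin : LpJohn.normFirstVariationTop f (LpJohn.gaussian 1) < ⊤) :
    0 < LpJohn.diamondMass f ∧
    (∀ φ : GL (Fin n) ℝ, ∃ d : ℝ, LpJohn.HasFirstVariation p f (LpJohn.gaussian φ) d) ∧
    (∃! g : LpJohn.E n → ℝ, LpJohn.IsSolution p f g) ∧
    ∀ φ : GL (Fin n) ℝ,
      (∀ y : LpJohn.E n, Integrable
        (fun x : LpJohn.E n => ⟪x, y⟫ ^ 2 * LpJohn.scaledSupport φ x ^ (p - 1))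
        (LpJohn.surfaceMeasure p f)) ∧
      (LpJohn.IsSolution p f (LpJohn.gaussian φ) ↔
        LpJohn.normFirstVariation p f (LpJohn.gaussian φ) = 1 ∧
        ∀ y : LpJohn.E n,
          LpJohn.scale φ ^ p * LpJohn.firstVariation p f (LpJohn.gaussian φ)
              * LpJohn.scaledPolarSupport φ y
            = n / (4 * p) * ∫ x, ⟪x, y⟫ ^ 2 * LpJohn.scaledSupport φ x ^ (p - 1)
                ∂(LpJohn.surfaceMeasure p f)) := by
  
  obtain ⟨u, hu, rfl⟩ := hf
  obtain ⟨U, k, rfl, hk, P⟩ := LpJohn.exists_convexPair hu hfin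
  set f := LpJohn.expNeg fun x => (U x : EReal) with hf
  have hfe : f = fun x => Real.exp (-(U x)) := funext fun x => LpJohn.expNeg_coe U x
  set μ := LpJohn.surfaceMeasure p f with hμ
  have hμe := P.surfaceMeasure_eq (p := p) hf hk
  have hmom : Integrable (fun x => (‖x‖ ^ 2) ^ p) μ := by
    rw [hμ, hμe]; exact P.integrable_sq_norm_rpow_surface hp
  have hnd : ∀ v : LpJohn.E n, v ≠ 0 → ¬ ∀ᵐ x ∂μ, ⟪v, x⟫ = 0 := fun v hv => by
    rw [hμ, hμe]; exact P.not_ae_inner_eq_zero_surface hp hv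
  set D := LpJohn.diamondMass f with hDdef
  have hD : 0 < D := by rw [hDdef, hfe]; exact P.diamondMass_pos hn
  have hp0 : 0 < p := by positivity
  have hfv := P.hasFirstVariation_gaussian hp hf hk
  have hfv' : ∀ φ : GL (Fin n) ℝ, LpJohn.firstVariation p f (LpJohn.gaussian φ) =
      1 / p * LpJohn.gaussMoment p μ (LpJohn.invTransposeL φ) := fun φ => (hfv φ).limUnder_eq
  have hnorm : ∀ φ : GL (Fin n) ℝ, LpJohn.normFirstVariation p f (LpJohn.gaussian φ) =
      (LpJohn.gaussMoment p μ (LpJohn.invTransposeL φ) / D) ^ (1 / p) := fun φ => by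
    rw [LpJohn.normFirstVariation, hfv', ← mul_assoc, mul_one_div_cancel hp0.ne', one_mul]
  have hmnn : ∀ φ : GL (Fin n) ℝ, 0 ≤ LpJohn.gaussMoment p μ (LpJohn.invTransposeL φ) / D := fun φ =>
    div_nonneg (LpJohn.gaussMoment_nonneg _) hD.le
  have hle : ∀ φ : GL (Fin n) ℝ, LpJohn.normFirstVariation p f (LpJohn.gaussian φ) ≤ 1 ↔
      LpJohn.gaussMoment p μ (LpJohn.invTransposeL φ) ≤ D := fun φ => by
    have h := Real.rpow_le_rpow_iff (hmnn φ) zero_le_one (show 0 < 1 / p by positivity)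
    rw [Real.one_rpow] at h
    rw [hnorm, h, div_le_one hD]
  have heq : ∀ φ : GL (Fin n) ℝ, LpJohn.normFirstVariation p f (LpJohn.gaussian φ) = 1 ↔
      LpJohn.gaussMoment p μ (LpJohn.invTransposeL φ) = D := fun φ => by
    have h := Real.rpow_left_inj (hmnn φ) zero_le_one (show 1 / p ≠ 0 by positivity)
    rw [Real.one_rpow] at h
    rw [hnorm, h, div_eq_one_iff_eq hD.ne']
  have hsol : ∀ φ : GL (Fin n) ℝ, LpJohn.IsSolution p f (LpJohn.gaussian φ) ↔
      LpJohn.IsOptimal p μ D φ := fun φ => by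
    simp only [LpJohn.IsSolution, LpJohn.IsOptimal, hle, LpJohn.J_gaussian_div_le_iff]
    exact ⟨fun h => h.2, fun h => ⟨⟨φ, rfl⟩, h⟩⟩
  have hsupp : ∀ (φ : GL (Fin n) ℝ) (x y : LpJohn.E n),
      ⟪x, y⟫ ^ 2 * LpJohn.scaledSupport φ x ^ (p - 1) = LpJohn.scale φ ^ (p - 1) *
        (⟪x, y⟫ ^ 2 * (‖LpJohn.invTransposeL φ x‖ ^ 2 / 2) ^ (p - 1)) := fun φ x y => by
    rw [LpJohn.scaledSupport_eq, Real.mul_rpow (LpJohn.scale_pos φ).le (by positivity)]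
    ring
  -- The scale cancels: the left side carries `α^p α⁻¹` and the right side `α^{p-1}`.
  have hcond : ∀ (φ : GL (Fin n) ℝ) (y : LpJohn.E n),
      (LpJohn.scale φ ^ p * LpJohn.firstVariation p f (LpJohn.gaussian φ)
        * LpJohn.scaledPolarSupport φ y = n / (4 * p) *
          ∫ x, ⟪x, y⟫ ^ 2 * LpJohn.scaledSupport φ x ^ (p - 1) ∂μ) ↔
      LpJohn.gaussMoment p μ (LpJohn.invTransposeL φ) * ‖LpJohn.act φ.val y‖ ^ 2 = n / 2 *
        ∫ x, ⟪x, y⟫ ^ 2 * (‖LpJohn.invTransposeL φ x‖ ^ 2 / 2) ^ (p - 1) ∂μ := fun φ y => by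
    have hα := LpJohn.scale_pos φ
    have hα' : 0 < LpJohn.scale φ ^ (p - 1) / (2 * p) := by positivity
    simp only [hsupp]
    rw [integral_const_mul, hfv', LpJohn.scaledPolarSupport_eq,
      ← LpJohn.rpow_sub_one_mul_self hp hα.le, ← mul_right_inj' hα'.ne'
        (b := LpJohn.gaussMoment p μ (LpJohn.invTransposeL φ) * _)]
    refine Eq.congr ?_ ?_ <;> field_simp
    ring
  refine ⟨hD, fun φ => ⟨_, hfv φ⟩, ?_, fun φ => ⟨fun y => ?_, ?_⟩⟩
  · obtain ⟨φ, hφ⟩ := LpJohn.exists_isOptimal hp hmom hn hnd hD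
    have hφD := hφ.gaussMoment_eq hp hmom hn hnd hD
    refine ⟨LpJohn.gaussian φ, (hsol φ).2 hφ, fun g hg => ?_⟩
    obtain ⟨ψ, rfl⟩ := hg.1
    funext x
    rw [LpJohn.gaussian, LpJohn.gaussian, (LpJohn.isOptimal_of_forall_mul_sq_norm_eq hp hmom hn hD
      hφD (hφ.mul_sq_norm_eq hp hmom hn hnd hD)).2 ψ ((hsol ψ).1 hg) x]
  · simp only [hsupp]
    refine (LpJohn.integrable_rpow_sub_one_mul hp hmom _ (by fun_prop) (c := ‖y‖ ^ 2)
      fun x => ?_).const_mul _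
    rw [abs_of_nonneg (by positivity), ← mul_pow, ← sq_abs, mul_comm ‖y‖]
    gcongr
    exact abs_real_inner_le_norm x y
  · rw [hsol, heq]
    simp only [hcond]
    constructor
    · intro h
      have hm := h.gaussMoment_eq hp hmom hn hnd hD
      exact ⟨hm, fun y => hm ▸ h.mul_sq_norm_eq hp hmom hn hnd hD y⟩
    · rintro ⟨hm, h⟩
      rw [hm] at h
      exact (LpJohn.isOptimal_of_forall_mul_sq_norm_eq hp hmom hn hD hm h).1
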